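/- Let $a\in C^1([-1,1])$ satisfy $a(x)>0$ for all $x\in(-1,1)$, $a(-1)=a(1)=0$, and $A\in L^1(-1,1)$, where $A(x)=\int_0^x \frac{ds}{a(s)}$. For $T\ge 0$, $v_0\in L^2(-1,1)$ and a static control $\alpha\in L^\infty(-1,1)$ consider the degenerate Cauchy–Neumann problem $$ \begin{cases} v_t-(a(x)v_x)_x=\alpha(x)\,v & \text{in } (0,T)\times(-1,1),\\ a(x)v_x(t,x)|_{x=\pm1}=0 & t\in(0,T),\\ v(0,x)=v_0(x) & x\in(-1,1). \end{cases} \tag{P} $$ Let $H^1_a(-1,1)$ be the space of $u\in L^2(-1,1)$ that are locally absolutely continuous in $(-1,1)$ with $\sqrt a\,u_x\in L^2(-1,1)$, and let $\mathcal A u=(au_x)_x+\alpha u$ be the operator in $L^2(-1,1)$ with domain $D(\mathcal A)=\{u\in H^1_a(-1,1): au_x\in H^1(-1,1),\ (au_x)(\pm1)=0\}$. A weak solution of (P) is a function $v\in C^0([0,T];L^2(-1,1))\cap L^2(0,T;H^1_a(-1,1))$ with $v(0)=v_0$ such that, for every $\varphi\in D(\mathcal A^*)$, the function $t\mapsto\langle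 v(t),\varphi\rangle_{L^2(-1,1)}$ is absolutely continuous on $[0,T]$ and $\frac{d}{dt}\langle v(t),\varphi\rangle=\langle v(t),\mathcal A^*\varphi\rangle$ for almost every $t\in(0,T)$. **Theorem.** Let $v_d\in L^2(-1,1)$ with $v_d\ge0$, and let $v_0\in L^2(-1,1)$ (not necessarily of one sign) satisfy $\int_{-1}^1 v_0v_d\,dx>0$. Then for every $\varepsilon>0$ there are a time $T=T(\varepsilon,v_0,v_d)\ge0$ and a static bilinear control $\alpha=\alpha(x)$, $\alpha\in L^\infty(-1,1)$, such that problem (P) has a unique weak solution $v$ on $[0,T]$, and $$\|v(T,\cdot)-v_d\|_{L^2(-1,1)}\le\varepsilon.$$ -/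

import Mathlib

open MeasureTheory Set
open scoped ENNReal

noncomputable section

namespace DegenerateParabolic

/-- Lebesgue measure on the interval `(-1, 1)`. -/
abbrev μI : Measure ℝ := volume.restrict (Ioo (-1 : ℝ) 1)

/-- The Hilbert space `L²(-1,1)`. -/
abbrev L2 : Type := Lp ℝ 2 μI

/-- The space `L^∞(-1,1)`. -/
abbrev LInf : Type := Lp ℝ ∞ μI

/-- `U` is locally absolutely continuous in the open interval `(-1, 1)`. -/
def LocallyAC (U : ℝ → ℝ) : Prop :=
  ∀ c d : ℝ, -1 < c → c ≤ d → d < 1 → AbsolutelyContinuousOnInterval U c d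

/-- `u ∈ H¹ₐ(-1,1)` and `g = √a uₓ ∈ L²(-1,1)`: the class `u` has a representative `U` that is
locally absolutely continuous in `(-1,1)` and `√a U'` is (a representative of) `g`. -/
def HasWeightedDeriv (a : ℝ → ℝ) (u g : L2) : Prop :=
  ∃ U : ℝ → ℝ, (u : ℝ → ℝ) =ᵐ[μI] U ∧ LocallyAC U ∧
    (g : ℝ → ℝ) =ᵐ[μI] fun x => √(a x) * deriv U x

/-- `u ∈ H²ₐ(-1,1)` and `f = (a uₓ)ₓ`: the class `u` has a representative `U`, locally absolutely
continuous in `(-1,1)`, with `√a U' ∈ L²(-1,1)`, whose flux `a U'` has a representative `W` that is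
absolutely continuous on `[-1,1]`, satisfies the boundary condition `W(±1) = 0`, and has
`W' = f ∈ L²(-1,1)`. -/
def HasDivForm (a : ℝ → ℝ) (u f : L2) : Prop :=
  ∃ U W : ℝ → ℝ, (u : ℝ → ℝ) =ᵐ[μI] U ∧ LocallyAC U ∧
    MemLp (fun x => √(a x) * deriv U x) 2 μI ∧
    W =ᵐ[μI] (fun x => a x * deriv U x) ∧ AbsolutelyContinuousOnInterval W (-1) 1 ∧
    W (-1) = 0 ∧ W 1 = 0 ∧ (f : ℝ → ℝ) =ᵐ[μI] deriv W

theorem LocallyAC.continuousOn {U : ℝ → ℝ} (hU : LocallyAC U) : ContinuousOn U (Ioo (-1) 1) := by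
  intro x hx
  have h := (hU ((-1 + x) / 2) ((x + 1) / 2) (by linarith [hx.1]) (by linarith [hx.1, hx.2])
    (by linarith [hx.2])).continuousOn
  rw [uIcc_of_le (by linarith [hx.1, hx.2])] at h
  exact (h.continuousAt (Icc_mem_nhds (by linarith [hx.1]) (by linarith [hx.2]))).continuousWithinAt

theorem LocallyAC.differentiable {U : ℝ → ℝ} (hU : LocallyAC U) :
    ∀ᵐ x ∂μI, DifferentiableAt ℝ U x := by
  have h : ∀ n : ℕ, ∀ᵐ x, x ∈ uIcc (-1 + 1 / ((n : ℝ) + 1)) (1 - 1 / ((n : ℝ) + 1)) →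
      DifferentiableAt ℝ U x := by
    intro n
    rcases Nat.eq_zero_or_pos n with rfl | hn
    · filter_upwards [(hU 0 0 (by norm_num) le_rfl (by norm_num)).ae_differentiableAt] with x hx
      intro hx'
      apply hx
      simpa using hx'
    · have h1 : (1 : ℝ) ≤ n := by exact_mod_cast hn
      have h2 : 1 / ((n : ℝ) + 1) ≤ 1 / 2 := by
        apply one_div_le_one_div_of_le <;> linarith
      have h3 : 0 < 1 / ((n : ℝ) + 1) := by positivity
      exact (hU _ _ (by linarith) (by linarith) (by linarith)).ae_differentiableAt
  rw [ae_restrict_iff' measurableSet_Ioo]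
  filter_upwards [ae_all_iff.2 h] with x hx hxI
  obtain ⟨n, hn⟩ := exists_nat_one_div_lt (show 0 < min (x + 1) (1 - x) from
    lt_min (by linarith [hxI.1]) (by linarith [hxI.2]))
  have h1 := hn.trans_le (min_le_left _ _)
  have h2 := hn.trans_le (min_le_right _ _)
  apply hx n
  rw [uIcc_of_le (by linarith)]
  exact ⟨by linarith, by linarith⟩

theorem ac_differentiable {W : ℝ → ℝ} (hW : AbsolutelyContinuousOnInterval W (-1) 1) :
    ∀ᵐ x ∂μI, DifferentiableAt ℝ W x := by
  rw [ae_restrict_iff' measurableSet_Ioo]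
  filter_upwards [hW.ae_differentiableAt] with x hx hxI
  apply hx
  rw [uIcc_of_le (by norm_num)]
  exact Ioo_subset_Icc_self hxI

/-- A continuous function on `(-1,1)` that vanishes a.e. has zero derivative there. -/
theorem deriv_eq_zero_of_ae {U : ℝ → ℝ} (hc : ContinuousOn U (Ioo (-1) 1)) (h : U =ᵐ[μI] 0) :
    deriv U =ᵐ[μI] 0 := by
  have h0 : EqOn U 0 (Ioo (-1) 1) :=
    Measure.eqOn_open_of_ae_eq h isOpen_Ioo hc continuousOn_const
  filter_upwards [ae_restrict_mem measurableSet_Ioo] with x hx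
  have : U =ᶠ[nhds x] fun _ => (0 : ℝ) :=
    Filter.eventuallyEq_of_mem (isOpen_Ioo.mem_nhds hx) h0
  simpa using this.deriv_eq

theorem HasDivForm.zero (a : ℝ → ℝ) : HasDivForm a 0 0 := by
  have hc : ∀ c d : ℝ, AbsolutelyContinuousOnInterval (fun _ : ℝ => (0 : ℝ)) c d := fun c d =>
    (LipschitzWith.const (0 : ℝ)).lipschitzOnWith.absolutelyContinuousOnInterval
  refine ⟨fun _ => 0, fun _ => 0, Lp.coeFn_zero _ _ _, fun c d _ _ _ => hc c d, by simp,
    by simp, hc _ _, rfl, rfl, ?_⟩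
  filter_upwards [Lp.coeFn_zero ℝ 2 μI] with x hx
  exact hx.trans (by simp)

theorem HasDivForm.add {a : ℝ → ℝ} {u u' f f' : L2} (h : HasDivForm a u f)
    (h' : HasDivForm a u' f') : HasDivForm a (u + u') (f + f') := by
  obtain ⟨U, W, h1, h2, h3, h4, h5, h6, h7, h8⟩ := h
  obtain ⟨U', W', h1', h2', h3', h4', h5', h6', h7', h8'⟩ := h'
  refine ⟨U + U', W + W', (Lp.coeFn_add u u').trans (h1.add h1'),
    fun c d hc hcd hd => (h2 c d hc hcd hd).add (h2' c d hc hcd hd), ?_, ?_, h5.add h5',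
    by simp [h6, h6'], by simp [h7, h7'], ?_⟩
  · refine (h3.add h3').ae_eq ?_
    filter_upwards [h2.differentiable, h2'.differentiable] with x hx hx'
    simp [deriv_add hx hx', mul_add]
  · filter_upwards [h2.differentiable, h2'.differentiable, h4, h4'] with x hx hx' k k'
    simp [deriv_add hx hx', mul_add, k, k']
  · filter_upwards [ac_differentiable h5, ac_differentiable h5', h8, h8', Lp.coeFn_add f f']
      with x hx hx' k k' l
    exact l.trans (by simp [deriv_add hx hx', k, k'])

theorem HasDivForm.smul {a : ℝ → ℝ} {u f : L2} (c : ℝ) (h : HasDivForm a u f) :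
    HasDivForm a (c • u) (c • f) := by
  obtain ⟨U, W, h1, h2, h3, h4, h5, h6, h7, h8⟩ := h
  refine ⟨fun x => c * U x, fun x => c * W x, ?_,
    fun r s hr hrs hs => (h2 r s hr hrs hs).const_mul c, ?_, ?_, h5.const_mul c,
    by simp [h6], by simp [h7], ?_⟩
  · filter_upwards [Lp.coeFn_smul c u, h1] with x k l
    simp [k, l]
  · refine (h3.const_mul c).ae_eq ?_
    filter_upwards with x
    simp only [deriv_const_mul_field]
    ring
  · filter_upwards [h4] with x k
    simp only [deriv_const_mul_field, k]
    ring
  · filter_upwards [h8, Lp.coeFn_smul c f] with x k l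
    simp [deriv_const_mul_field, k, l]

theorem HasDivForm.eq_zero {a : ℝ → ℝ} {f : L2} (h : HasDivForm a 0 f) : f = 0 := by
  obtain ⟨U, W, h1, h2, -, h4, h5, -, -, h8⟩ := h
  have hU : U =ᵐ[μI] 0 := h1.symm.trans (Lp.coeFn_zero ℝ 2 μI)
  have hW : W =ᵐ[μI] 0 := by
    filter_upwards [h4, deriv_eq_zero_of_ae h2.continuousOn hU] with x k l
    simp [k, l]
  have hWc : ContinuousOn W (Ioo (-1) 1) := by
    refine h5.continuousOn.mono ?_
    rw [uIcc_of_le (by norm_num)]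
    exact Ioo_subset_Icc_self
  exact Lp.ext (h8.trans ((deriv_eq_zero_of_ae hWc hW).trans (Lp.coeFn_zero ℝ 2 μI).symm))

/-- The graph `{(u, (a uₓ)ₓ) : u ∈ H²ₐ(-1,1)}`, as a subspace of `L² × L²`. -/
def graphA₀ (a : ℝ → ℝ) : Submodule ℝ (L2 × L2) where
  carrier := {p | HasDivForm a p.1 p.2}
  add_mem' := HasDivForm.add
  zero_mem' := HasDivForm.zero a
  smul_mem' c _ h := HasDivForm.smul c h

/-- The unbounded operator `A₀ u = (a uₓ)ₓ` in `L²(-1,1)` with domain `D(A₀) = H²ₐ(-1,1)`. -/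
def A₀ (a : ℝ → ℝ) : L2 →ₗ.[ℝ] L2 := (graphA₀ a).toLinearPMap

/-- `u ∈ D(A₀)` and `A₀ u = f` hold exactly when `u ∈ H²ₐ(-1,1)` and `(a uₓ)ₓ = f`. -/
theorem mem_graph_A₀ (a : ℝ → ℝ) (u f : L2) : (u, f) ∈ (A₀ a).graph ↔ HasDivForm a u f := by
  rw [A₀, Submodule.toLinearPMap_graph_eq]
  · rfl
  · rintro ⟨u, f⟩ h (rfl : u = 0)
    exact HasDivForm.eq_zero h

/-- Multiplication `u ↦ α u` by `α ∈ L^∞(-1,1)`, as an operator on `L²(-1,1)`. -/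
def mulOp (α : LInf) : L2 →ₗ[ℝ] L2 := (ContinuousLinearMap.mul ℝ ℝ).holderₗ μI ∞ 2 2 α

/-- The operator `A = A₀ + α I`, with domain `D(A) = D(A₀) = H²ₐ(-1,1)`. -/
def opA (a : ℝ → ℝ) (α : LInf) : L2 →ₗ.[ℝ] L2 := mulOp α +ᵥ A₀ a

/-- `v` is a weak solution on `[0,T]` of
`vₜ - (a vₓ)ₓ = α(x) v` in `(0,T) × (-1,1)`, `a vₓ = 0` at `x = ±1`, `v(0,·) = v₀`:
`v ∈ C⁰([0,T]; L²(-1,1)) ∩ L²(0,T; H¹ₐ(-1,1))`, `v(0) = v₀`, and for every `φ ∈ D(A*)` the function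
`t ↦ ⟨v(t), φ⟩` is absolutely continuous on `[0,T]` with
`d/dt ⟨v(t), φ⟩ = ⟨v(t), A* φ⟩` for a.e. `t`. -/
structure IsWeakSolution (a : ℝ → ℝ) (α : LInf) (T : ℝ) (v₀ : L2) (v : ℝ → L2) : Prop where
  continuousOn : ContinuousOn v (Icc 0 T)
  -- `g(t) = √a vₓ(t,·)` is square integrable in time with values in `L²(-1,1)`
  energy : ∃ g : ℝ → L2, MemLp g 2 (volume.restrict (Ioo 0 T)) ∧
    ∀ᵐ t ∂volume.restrict (Ioo 0 T), HasWeightedDeriv a (v t) (g t)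
  initial : v 0 = v₀
  weak : ∀ φ : (opA a α).adjoint.domain,
    AbsolutelyContinuousOnInterval (fun t => inner ℝ (v t) (φ : L2)) 0 T ∧
    ∀ᵐ t ∂volume.restrict (Ioo 0 T),
      HasDerivAt (fun s => inner ℝ (v s) (φ : L2)) (inner ℝ (v t) ((opA a α).adjoint φ)) t

end DegenerateParabolic

end

/-! Approximate `vd` by a polynomial p that is positive on [-1,1] and so close to `vd` that ⟨v₀, p⟩
> 0. The potential α⋆ = -(a p')'/p makes p stationary; it is bounded because a is C¹ and p is
bounded away from 0. With D u = √a u' - √a (p'/p) u = √a p (u/p)', the operator A₀ + α⋆ is -D*D: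
self-adjoint, nonpositive, with kernel spanned by p. Its semigroup therefore converges strongly to
the orthogonal projection on p, so S(t)v₀ → βp with β = ⟨v₀, p⟩/‖p‖² > 0. Adding a constant δ to the
potential multiplies the solution by exp(δt). For T large and exp(δT) = 1/β the final state is close
to p, hence to `vd`. Strong convergence suffices: neither compactness nor a spectral gap is needed.

The operator theory is done with bounded operators. Projecting (z, 0) onto the closed graph of D
gives J = (1 + D*D)⁻¹ and R = D J (`exists_isGraphResolvent`). With C = 1 - J the generator is -C(1
- C)⁻¹, the limit of the partial sums -(C + ⋯ + Cⁿ) (`IsResolventComplement.exists_semigroup`).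
Convergence of Cⁿx and of S(t)x comes from the monotonicity of ⟨Cⁿx, x⟩ and ⟨S(t)x, x⟩.

The link with the differential operator is `exists_mem_twistedGraph` together with
`hasDivForm_of_weak`, the two inclusions between A₀ + α⋆ and -D*D; boundary terms vanish because
a(x) = O(1 - |x|). Existence, regularity and uniqueness of the weak solution rest on `weak_form`,
`exists_energy` and `eqOn_zero_of_weak`. -/

noncomputable section

namespace DegenerateParabolic

set_option linter.unusedSectionVars false

open Filter Topology NormedSpace
open scoped RealInnerProductSpace

/-! ### Exponentials of bounded dissipative operators -/

section Exponential

variable {H : Type*} [NormedAddCommGroup H] [InnerProductSpace ℝ H] [CompleteSpace H]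

/-- A family whose mutual distances are given by a convergent "Hankel" kernel is convergent. -/
theorem exists_tendsto_of_norm_sub_sq {ι : Type*} [AddCommMonoid ι] [LinearOrder ι]
    [IsOrderedAddMonoid ι] {u : ι → H} {g : ι → ℝ} {L : ℝ} (hg : Tendsto g atTop (𝓝 L))
    (h : ∀ i j, 0 ≤ i → 0 ≤ j → ‖u i - u j‖ ^ 2 = g (i + i) - 2 * g (i + j) + g (j + j)) :
    ∃ y, Tendsto u atTop (𝓝 y) := by
  have : Nonempty ι := ⟨0⟩
  refine cauchySeq_tendsto_of_complete ?_
  rw [Metric.cauchySeq_iff]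
  intro ε hε
  obtain ⟨M, hM⟩ := Metric.tendsto_atTop.1 hg (ε ^ 2 / 4) (by positivity)
  refine ⟨max M 0, fun i hi j hj => ?_⟩
  have hi0 : 0 ≤ i := (le_max_right _ _).trans hi
  have hj0 : 0 ≤ j := (le_max_right _ _).trans hj
  have hiM : M ≤ i := (le_max_left _ _).trans hi
  have hjM : M ≤ j := (le_max_left _ _).trans hj
  have h1 := abs_lt.1 (hM (i + i) (hiM.trans (le_add_of_nonneg_left hi0)))
  have h2 := abs_lt.1 (hM (i + j) (hiM.trans (le_add_of_nonneg_right hj0)))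
  have h3 := abs_lt.1 (hM (j + j) (hjM.trans (le_add_of_nonneg_left hj0)))
  rw [dist_eq_norm]
  -- The weights 1, -2, 1 sum to zero and have total mass 4, so it suffices that g is within ε²/4 of
  -- L at the three points.
  refine lt_of_pow_lt_pow_left₀ 2 hε.le ?_
  rw [h i j hi0 hj0]
  linarith [h1.1, h1.2, h2.1, h2.2, h3.1, h3.2]

theorem hasDerivAt_exp_smul_apply (B : H →L[ℝ] H) (x : H) (t : ℝ) :
    HasDerivAt (fun s : ℝ => exp (s • B) x) (exp (t • B) (B x)) t := by
  have h := (hasDerivAt_exp_smul_const (𝕂 := ℝ) B t).clm_apply (hasDerivAt_const t x)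
  simpa using h

theorem hasDerivAt_exp_smul_apply' (B : H →L[ℝ] H) (x : H) (t : ℝ) :
    HasDerivAt (fun s : ℝ => exp (s • B) x) (B (exp (t • B) x)) t := by
  have h := (hasDerivAt_exp_smul_const' (𝕂 := ℝ) B t).clm_apply (hasDerivAt_const t x)
  simpa using h

/-- The derivative of ‖exp(sB)x‖² is 2⟨B exp(sB)x, exp(sB)x⟩, which is nonpositive. -/
theorem norm_exp_smul_apply_le {B : H →L[ℝ] H} (hB : ∀ x, ⟪B x, x⟫ ≤ 0) {t : ℝ} (ht : 0 ≤ t)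
    (x : H) : ‖exp (t • B) x‖ ≤ ‖x‖ := by
  have hd : ∀ s : ℝ, HasDerivAt (fun s : ℝ => ‖exp (s • B) x‖ ^ 2)
      (2 * ⟪exp (s • B) x, B (exp (s • B) x)⟫) s := fun s =>
    (hasDerivAt_exp_smul_apply' B x s).norm_sq
  have hanti : Antitone fun s : ℝ => ‖exp (s • B) x‖ ^ 2 :=
    antitone_of_deriv_nonpos (fun s => (hd s).differentiableAt) fun s => by
      rw [(hd s).deriv, real_inner_comm]
      linarith [hB (exp (s • B) x)]
  have := hanti ht
  simp only [zero_smul, exp_zero, one_apply_eq_self] at this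
  exact (sq_le_sq₀ (norm_nonneg _) (norm_nonneg _)).1 this

theorem norm_exp_smul_apply_sub_le {B : H →L[ℝ] H} (hB : ∀ x, ⟪B x, x⟫ ≤ 0) {t : ℝ}
    (ht : 0 ≤ t) (x : H) : ‖exp (t • B) x - x‖ ≤ t * ‖B x‖ := by
  have := norm_image_sub_le_of_norm_deriv_le_segment' (a := 0) (b := t) (C := ‖B x‖)
    (f := fun s : ℝ => exp (s • B) x)
    (fun s _ => (hasDerivAt_exp_smul_apply B x s).hasDerivWithinAt)
    (fun s hs => norm_exp_smul_apply_le hB hs.1 _) t ⟨ht, le_rfl⟩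
  simp only [zero_smul, exp_zero, one_apply_eq_self, sub_zero] at this
  linarith

theorem exp_smul_add_apply {B B' : H →L[ℝ] H} (h : Commute B B') (t : ℝ) (x : H) :
    exp (t • (B + B')) x = exp (t • B) (exp (t • B') x) := by
  let : NormedAlgebra ℚ (H →L[ℝ] H) := .restrictScalars ℚ ℝ _
  rw [smul_add, exp_add_of_commute ((h.smul_left t).smul_right t)]
  rfl

theorem exp_add_smul_apply (B : H →L[ℝ] H) (s t : ℝ) (x : H) :
    exp ((s + t) • B) x = exp (s • B) (exp (t • B) x) := by
  let : NormedAlgebra ℚ (H →L[ℝ] H) := .restrictScalars ℚ ℝ _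
  rw [add_smul, exp_add_of_commute (((Commute.refl B).smul_left s).smul_right t)]
  rfl

theorem exp_smul_symm {B : H →L[ℝ] H} (hB : ∀ x y, ⟪B x, y⟫ = ⟪x, B y⟫) (t : ℝ) (x y : H) :
    ⟪exp (t • B) x, y⟫ = ⟪x, exp (t • B) y⟫ := by
  have h1 : IsSelfAdjoint B :=
    ContinuousLinearMap.isSelfAdjoint_iff_isSymmetric.2 fun x y => hB x y
  have h2 : IsSelfAdjoint (exp (t • B)) := (IsSelfAdjoint.smul (IsSelfAdjoint.all t) h1).exp
  exact (ContinuousLinearMap.isSelfAdjoint_iff_isSymmetric.1 h2) x y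

theorem exp_smul_apply_comm {B C : H →L[ℝ] H} (h : Commute B C) (t : ℝ) (x : H) :
    exp (t • B) (C x) = C (exp (t • B) x) := by
  have h2 : Commute (exp (t • B)) C := (h.smul_left t).exp_left
  exact congrArg (fun T : H →L[ℝ] H => T x) h2.eq

end Exponential

/-! ### The contraction semigroup built from a resolvent -/

section Semigroup

variable {H : Type*} [NormedAddCommGroup H] [InnerProductSpace ℝ H] [CompleteSpace H]

/-- `C` is symmetric, firmly nonexpansive and `1 - C` is injective; equivalently `1 - C` is the
resolvent `(1 - A)⁻¹` of a nonpositive self-adjoint operator `A`. -/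
structure IsResolventComplement (C : H →L[ℝ] H) : Prop where
  symm : ∀ x y, ⟪C x, y⟫ = ⟪x, C y⟫
  norm_sq_le : ∀ x, ‖C x‖ ^ 2 ≤ ⟪C x, x⟫
  eq_zero : ∀ x, C x = x → x = 0

/-- The `n`-th bounded approximation `-(C + C² + ⋯ + Cⁿ)` of the generator `-C (1 - C)⁻¹`. -/
def approxGenerator (C : H →L[ℝ] H) (n : ℕ) : H →L[ℝ] H := -∑ k ∈ Finset.range n, C ^ (k + 1)

namespace IsResolventComplement

variable {C : H →L[ℝ] H} (hC : IsResolventComplement C)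
include hC

theorem inner_nonneg (x : H) : 0 ≤ ⟪C x, x⟫ := (sq_nonneg _).trans (hC.norm_sq_le x)

theorem norm_le (x : H) : ‖C x‖ ≤ ‖x‖ := by
  have h1 := hC.norm_sq_le x
  have h2 := real_inner_le_norm (C x) x
  by_contra! h
  nlinarith [norm_nonneg x]

theorem pow_symm (n : ℕ) (x y : H) : ⟪(C ^ n) x, y⟫ = ⟪x, (C ^ n) y⟫ := by
  induction n generalizing x y with
  | zero => simp
  | succ n ih =>
    rw [pow_succ, mul_apply_eq_comp, ih, hC.symm, ← mul_apply_eq_comp,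
      ← pow_succ', ← pow_succ]

theorem inner_pow_add (m n : ℕ) (x y : H) : ⟪(C ^ m) x, (C ^ n) y⟫ = ⟪(C ^ (n + m)) x, y⟫ := by
  rw [← hC.pow_symm, pow_add, mul_apply_eq_comp]

theorem inner_pow_nonneg (n : ℕ) (x : H) : 0 ≤ ⟪(C ^ n) x, x⟫ := by
  rcases Nat.even_or_odd' n with ⟨m, rfl | rfl⟩
  · rw [two_mul, ← hC.inner_pow_add]
    exact real_inner_self_nonneg
  · rw [show 2 * m + 1 = m + (m + 1) by ring, ← hC.inner_pow_add, pow_succ',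
      mul_apply_eq_comp]
    exact hC.inner_nonneg _

/-- With y = Cᵐx the consecutive terms are ‖y‖², ⟨Cy, y⟩, ‖Cy‖². The two steps down are
nonexpansiveness and firm nonexpansiveness of C. -/
theorem inner_pow_antitone (x : H) : Antitone fun n => ⟪(C ^ n) x, x⟫ := by
  refine antitone_nat_of_succ_le fun n => ?_
  rcases Nat.even_or_odd' n with ⟨m, rfl | rfl⟩
  · rw [show 2 * m + 1 = m + (m + 1) by ring, two_mul, ← hC.inner_pow_add (m + 1) m,
      ← hC.inner_pow_add m m, pow_succ' C m, mul_apply_eq_comp]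
    refine (real_inner_le_norm _ _).trans ?_
    rw [real_inner_self_eq_norm_mul_norm]
    exact mul_le_mul_of_nonneg_right (hC.norm_le _) (norm_nonneg _)
  · rw [show 2 * m + 1 + 1 = (m + 1) + (m + 1) by ring, show 2 * m + 1 = m + (m + 1) by ring,
      ← hC.inner_pow_add (m + 1) (m + 1), ← hC.inner_pow_add (m + 1) m, pow_succ' C m, mul_apply_eq_comp,
      real_inner_self_eq_norm_sq]
    exact hC.norm_sq_le _

/-- Expanding ‖Cⁱx - Cʲx‖² by symmetry leaves only values of the monotone sequence ⟨Cⁿx, x⟩, so Cⁿx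
converges. The limit is fixed by C, hence zero. -/
theorem pow_tendsto_zero (x : H) : Tendsto (fun n => (C ^ n) x) atTop (𝓝 0) := by
  have hg := tendsto_atTop_ciInf (hC.inner_pow_antitone x)
    ⟨0, by rintro _ ⟨n, rfl⟩; exact hC.inner_pow_nonneg n x⟩
  obtain ⟨y, hy⟩ := exists_tendsto_of_norm_sub_sq (u := fun n => (C ^ n) x) hg fun i j _ _ => by
    rw [norm_sub_sq_real, ← real_inner_self_eq_norm_sq, ← real_inner_self_eq_norm_sq,
      hC.inner_pow_add, hC.inner_pow_add, hC.inner_pow_add, add_comm j i]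
  have h1 : Tendsto (fun n => (C ^ (n + 1)) x) atTop (𝓝 (C y)) := by
    simpa only [pow_succ', mul_apply_eq_comp, Function.comp_def] using
      (C.continuous.tendsto y).comp hy
  have h2 := tendsto_nhds_unique h1 (hy.comp (tendsto_add_atTop_nat 1))
  rwa [hC.eq_zero y h2] at hy

/-- By symmetry the orthogonal complement of the range of 1 - C is the kernel of 1 - C, which is
trivial. -/
theorem denseRange : DenseRange fun x => x - C x := by
  have hz : (LinearMap.range (1 - C : H →L[ℝ] H).toLinearMap)ᗮ = ⊥ := by
    rw [Submodule.eq_bot_iff]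
    intro x hx
    refine hC.eq_zero x ?_
    rw [Submodule.mem_orthogonal] at hx
    have h1 : ∀ y, ⟪y, x - C x⟫ = 0 := fun y => by
      have := hx _ ⟨y, rfl⟩
      simp only [ContinuousLinearMap.coe_coe, sub_apply,
        one_apply_eq_self, inner_sub_left, hC.symm] at this
      rw [inner_sub_right, this]
    exact (sub_eq_zero.1 (inner_self_eq_zero.1 (h1 _))).symm
  have := Submodule.topologicalClosure_eq_top_iff.2 hz
  rw [← Submodule.dense_iff_topologicalClosure_eq_top] at this
  exact this

theorem approxGenerator_symm (n : ℕ) (x y : H) :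
    ⟪approxGenerator C n x, y⟫ = ⟪x, approxGenerator C n y⟫ := by
  simp only [approxGenerator, neg_apply, sum_apply, sum_inner, inner_sum, inner_neg_left,
    inner_neg_right, hC.pow_symm]

theorem approxGenerator_nonpos (n : ℕ) (x : H) : ⟪approxGenerator C n x, x⟫ ≤ 0 := by
  simp only [approxGenerator, neg_apply, sum_apply,
    sum_inner, inner_neg_left, neg_nonpos]
  exact Finset.sum_nonneg fun k _ => hC.inner_pow_nonneg _ _

theorem approxGenerator_diff_nonpos {m n : ℕ} (h : m ≤ n) (x : H) :
    ⟪(approxGenerator C n - approxGenerator C m) x, x⟫ ≤ 0 := by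
  rw [show approxGenerator C n - approxGenerator C m = -∑ k ∈ Finset.Ico m n, C ^ (k + 1) by
    rw [Finset.sum_Ico_eq_sub _ h]; simp only [approxGenerator]; abel]
  simp only [neg_apply, sum_apply,
    sum_inner, inner_neg_left, neg_nonpos]
  exact Finset.sum_nonneg fun k _ => hC.inner_pow_nonneg _ _

omit hC in
theorem approxGenerator_commute (n : ℕ) : Commute (approxGenerator C n) C := by
  refine Commute.neg_left (Commute.sum_left _ _ _ fun k _ => ?_)
  exact (Commute.refl C).pow_left _

omit hC in
theorem approxGenerator_commute' (m n : ℕ) :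
    Commute (approxGenerator C n) (approxGenerator C m) := by
  refine Commute.neg_right (Commute.sum_right _ _ _ fun k _ => ?_)
  exact (approxGenerator_commute n).pow_right _

-- The sum telescopes: (C + ⋯ + Cⁿ)(1 - C) = C - Cⁿ⁺¹.
omit hC in
theorem approxGenerator_apply (n : ℕ) (y : H) :
    approxGenerator C n (y - C y) = -(C y - (C ^ n) (C y)) := by
  induction n with
  | zero => simp [approxGenerator]
  | succ n ih =>
    have : approxGenerator C (n + 1) = approxGenerator C n - C ^ (n + 1) := by
      simp only [approxGenerator, Finset.sum_range_succ]; abel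
    rw [this, sub_apply, ih, map_sub, pow_succ, mul_apply_eq_comp,
      mul_apply_eq_comp]
    abel

theorem approxGenerator_tendsto (y : H) :
    Tendsto (fun n => approxGenerator C n (y - C y)) atTop (𝓝 (-C y)) := by
  simp only [approxGenerator_apply]
  simpa using (tendsto_const_nhds.sub (hC.pow_tendsto_zero (C y))).neg

theorem norm_exp_approx_le {t : ℝ} (ht : 0 ≤ t) (n : ℕ) (x : H) :
    ‖exp (t • approxGenerator C n) x‖ ≤ ‖x‖ :=
  norm_exp_smul_apply_le (hC.approxGenerator_nonpos n) ht x

/-- For m ≤ n the larger approximation is the smaller one plus a commuting dissipative operator. The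
exponential factors, and the common factor is a contraction. -/
theorem norm_exp_approx_sub_le {t : ℝ} (ht : 0 ≤ t) (m n : ℕ) (x : H) :
    ‖exp (t • approxGenerator C n) x - exp (t • approxGenerator C m) x‖ ≤
      t * ‖approxGenerator C n x - approxGenerator C m x‖ := by
  wlog h : m ≤ n generalizing m n
  · rw [norm_sub_rev, norm_sub_rev (approxGenerator C n x)]
    exact this n m (le_of_not_ge h)
  have h1 : Commute (approxGenerator C m) (approxGenerator C n - approxGenerator C m) :=
    (approxGenerator_commute' n m).sub_right (Commute.refl _)
  have h2 := exp_smul_add_apply h1 t x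
  rw [add_sub_cancel] at h2
  rw [h2, ← map_sub]
  exact (hC.norm_exp_approx_le ht m _).trans
    (norm_exp_smul_apply_sub_le (hC.approxGenerator_diff_nonpos h) ht x)

theorem uniformCauchySeqOn_exp_approx (T : ℝ) (x : H) :
    UniformCauchySeqOn (fun n (t : ℝ) => exp (t • approxGenerator C n) x) atTop (Icc 0 T) := by
  rw [Metric.uniformCauchySeqOn_iff]
  intro ε hε
  -- The approximate generators converge only on the range of 1 - C. Contractivity absorbs the error
  -- of replacing x by y - Cy, once for each index.
  obtain ⟨y, hy⟩ := Metric.denseRange_iff.1 hC.denseRange x (ε / 4) (by positivity)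
  rw [dist_eq_norm] at hy
  have hcs := (hC.approxGenerator_tendsto y).cauchySeq
  obtain ⟨N, hN⟩ := Metric.cauchySeq_iff.1 hcs (ε / (4 * (|T| + 1))) (by positivity)
  refine ⟨N, fun m hm n hn t ht => ?_⟩
  have h1 := hN m hm n hn
  rw [dist_eq_norm] at h1 ⊢
  have h2 := hC.norm_exp_approx_sub_le ht.1 n m (y - C y)
  have h3 := hC.norm_exp_approx_le ht.1 m (x - (y - C y))
  have h4 := hC.norm_exp_approx_le ht.1 n (x - (y - C y))
  have h5 : exp (t • approxGenerator C m) x - exp (t • approxGenerator C n) x =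
      exp (t • approxGenerator C m) (x - (y - C y)) - exp (t • approxGenerator C n) (x - (y - C y))
      + (exp (t • approxGenerator C m) (y - C y) - exp (t • approxGenerator C n) (y - C y)) := by
    simp only [map_sub]; abel
  have h6 : t * ‖approxGenerator C m (y - C y) - approxGenerator C n (y - C y)‖ ≤ ε / 4 := by
    calc _ ≤ (|T| + 1) * (ε / (4 * (|T| + 1))) := by
          refine mul_le_mul ?_ h1.le (norm_nonneg _) (by positivity)
          linarith [ht.2, le_abs_self T]
      _ = ε / 4 := by field_simp
  rw [h5]
  refine (norm_add_le _ _).trans_lt ?_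
  have h7 := norm_sub_le (exp (t • approxGenerator C m) (x - (y - C y)))
    (exp (t • approxGenerator C n) (x - (y - C y)))
  linarith

end IsResolventComplement

/-- `S` is the contraction semigroup generated by `-C (1 - C)⁻¹`. -/
structure IsSemigroupOf (C : H →L[ℝ] H) (S : ℝ → H →L[ℝ] H) : Prop where
  norm_le : ∀ t, 0 ≤ t → ∀ x, ‖S t x‖ ≤ ‖x‖
  zero : ∀ x, S 0 x = x
  add : ∀ s t, 0 ≤ s → 0 ≤ t → ∀ x, S (s + t) x = S s (S t x)
  symm : ∀ t, 0 ≤ t → ∀ x y, ⟪S t x, y⟫ = ⟪x, S t y⟫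
  comm : ∀ t, 0 ≤ t → ∀ x, S t (C x) = C (S t x)
  continuousOn : ∀ x, ContinuousOn (fun t => S t x) (Ici 0)
  hasDerivAt : ∀ t, 0 < t → ∀ x, HasDerivAt (fun s => S s (x - C x)) (-S t (C x)) t

theorem IsResolventComplement.exists_semigroup {C : H →L[ℝ] H} (hC : IsResolventComplement C) :
    ∃ S, IsSemigroupOf C S := by
  have hex : ∀ t : ℝ, 0 ≤ t → ∃ T : H →L[ℝ] H, ∀ x,
      Tendsto (fun n => exp (t • approxGenerator C n) x) atTop (𝓝 (T x)) := by
    intro t ht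
    have : ∀ x, ∃ y, Tendsto (fun n => exp (t • approxGenerator C n) x) atTop (𝓝 y) := fun x =>
      cauchySeq_tendsto_of_complete
        ((hC.uniformCauchySeqOn_exp_approx t x).cauchySeq ⟨ht, le_rfl⟩)
    choose f hf using this
    exact ⟨continuousLinearMapOfTendsto (fun n => exp (t • approxGenerator C n))
      (tendsto_pi_nhds.2 hf), hf⟩
  choose! S hS using hex
  have hunif : ∀ T x, TendstoUniformlyOn (fun n (t : ℝ) => exp (t • approxGenerator C n) x)
      (fun t => S t x) atTop (Icc 0 T) := fun T x =>
    (hC.uniformCauchySeqOn_exp_approx T x).tendstoUniformlyOn_of_tendsto fun t ht => hS t ht.1 x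
  have hle : ∀ t, 0 ≤ t → ∀ x, ‖S t x‖ ≤ ‖x‖ := fun t ht x =>
    le_of_tendsto (hS t ht x).norm (Eventually.of_forall fun n => hC.norm_exp_approx_le ht n x)
  refine ⟨S, hle, ?_, ?_, ?_, ?_, ?_, ?_⟩
  · intro x
    refine tendsto_nhds_unique (hS 0 le_rfl x) ?_
    simp
  · intro s t hs ht x
    refine tendsto_nhds_unique (hS (s + t) (add_nonneg hs ht) x) ?_
    have h1 : Tendsto (fun n => exp (s • approxGenerator C n)
        (exp (t • approxGenerator C n) x - S t x)) atTop (𝓝 0) := by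
      refine squeeze_zero_norm (fun n => hC.norm_exp_approx_le hs n _) ?_
      simpa using ((hS t ht x).sub_const (S t x)).norm
    have h2 := h1.add (hS s hs (S t x))
    simp only [map_sub, sub_add_cancel, zero_add] at h2
    simpa only [exp_add_smul_apply] using h2
  · intro t ht x y
    refine tendsto_nhds_unique ((hS t ht x).inner tendsto_const_nhds) ?_
    simp only [exp_smul_symm (hC.approxGenerator_symm _)]
    exact tendsto_const_nhds.inner (hS t ht y)
  · intro t ht x
    refine tendsto_nhds_unique (hS t ht (C x)) ?_
    simp only [exp_smul_apply_comm (IsResolventComplement.approxGenerator_commute _)]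
    exact (C.continuous.tendsto _).comp (hS t ht x)
  · intro x t ht
    have h1 : ContinuousOn (fun t => S t x) (Icc 0 (t + 1)) :=
      (hunif (t + 1) x).continuousOn (Frequently.of_forall fun n =>
        (continuous_iff_continuousAt.2 fun s =>
          (hasDerivAt_exp_smul_apply (approxGenerator C n) x s).continuousAt).continuousOn)
    refine (h1 t ⟨ht, by linarith⟩).mono_of_mem_nhdsWithin ?_
    filter_upwards [inter_mem_nhdsWithin (Ici (0 : ℝ)) (Iio_mem_nhds (show t < t + 1 by linarith))]
      with s hs using ⟨hs.1, le_of_lt hs.2⟩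
  · intro t ht x
    -- On the range of 1 - C the derivatives converge uniformly in time, so differentiation passes
    -- to the limit.
    refine hasDerivAt_of_tendstoUniformlyOn (s := Ioo 0 (t + 1)) (l := atTop) isOpen_Ioo
      (f := fun n (s : ℝ) => exp (s • approxGenerator C n) (x - C x))
      (f' := fun n (s : ℝ) => exp (s • approxGenerator C n) (approxGenerator C n (x - C x)))
      (g' := fun s => -S s (C x)) ?_ ?_ ?_ ⟨ht, by linarith⟩
    · have h1 := (hunif (t + 1) (-C x)).mono Ioo_subset_Icc_self
      rw [Metric.tendstoUniformlyOn_iff] at h1 ⊢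
      intro ε hε
      filter_upwards [h1 (ε / 2) (by positivity),
        Metric.tendsto_nhds.1 (hC.approxGenerator_tendsto x) (ε / 2) (by positivity)]
        with n hn hn' s hs
      have h3 := hn s hs
      rw [map_neg] at h3
      refine (dist_triangle _ _ _).trans_lt (b := dist _ (exp (s • approxGenerator C n) (-C x))
        + _) ?_
      have h2 : dist (exp (s • approxGenerator C n) (-C x))
          (exp (s • approxGenerator C n) (approxGenerator C n (x - C x))) < ε / 2 := by
        rw [dist_comm, dist_eq_norm, ← map_sub]
        rw [dist_eq_norm] at hn'
        exact (hC.norm_exp_approx_le hs.1.le n _).trans_lt hn'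
      linarith
    · exact Eventually.of_forall fun n s _ => hasDerivAt_exp_smul_apply _ _ s
    · exact fun s hs => hS s hs.1.le _

end Semigroup

/-! ### The resolvent of D*D for a closed operator D -/

section GraphResolvent

variable {H K : Type*} [NormedAddCommGroup H] [InnerProductSpace ℝ H] [CompleteSpace H]
  [NormedAddCommGroup K] [InnerProductSpace ℝ K] [CompleteSpace K]

/-- If `G` is the graph of `D`, then `J = (1 + D*D)⁻¹` and `R = D J`. -/
structure IsGraphResolvent (G : Submodule ℝ (H × K)) (J : H →L[ℝ] H) (R : H →L[ℝ] K) : Prop where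
  mem : ∀ z, (J z, R z) ∈ G
  inner_eq : ∀ z, ∀ p ∈ G, ⟪z - J z, p.1⟫ = ⟪R z, p.2⟫

/-- (Jz, Rz) is the orthogonal projection of (z, 0) on G for the Hilbert norm of the product. The
residual (z - Jz, -Rz) is orthogonal to G, which is the required identity. -/
theorem exists_isGraphResolvent (G : Submodule ℝ (H × K)) (hG : IsClosed (G : Set (H × K))) :
    ∃ J R, IsGraphResolvent G J R := by
  let e := WithLp.prodContinuousLinearEquiv 2 ℝ H K
  let G' : Submodule ℝ (WithLp 2 (H × K)) := G.comap e.toLinearEquiv.toLinearMap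
  have hcl : IsClosed (G' : Set (WithLp 2 (H × K))) := hG.preimage e.continuous
  have : CompleteSpace G' := hcl.completeSpace_coe
  let Q : H →L[ℝ] H × K := e.toContinuousLinearMap ∘L G'.starProjection ∘L
    e.symm.toContinuousLinearMap ∘L ContinuousLinearMap.inl ℝ H K
  refine ⟨ContinuousLinearMap.fst ℝ H K ∘L Q, ContinuousLinearMap.snd ℝ H K ∘L Q, ?_, ?_⟩
  · intro z
    exact Submodule.starProjection_apply_mem G' (e.symm (z, 0))
  · intro z p hp
    have h := G'.starProjection_inner_eq_zero (e.symm (z, 0)) (e.symm p)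
      (show e (e.symm p) ∈ G by simpa using hp)
    rw [WithLp.prod_inner_apply] at h
    have h2 : ⟪z - (Q z).1, p.1⟫ + ⟪0 - (Q z).2, p.2⟫ = 0 := h
    rw [zero_sub, inner_neg_left] at h2
    show ⟪z - (Q z).1, p.1⟫ = ⟪(Q z).2, p.2⟫
    linarith

namespace IsGraphResolvent

variable {G : Submodule ℝ (H × K)} {J : H →L[ℝ] H} {R : H →L[ℝ] K} (h : IsGraphResolvent G J R)
include h

theorem symm (x y : H) : ⟪J x, y⟫ = ⟪x, J y⟫ := by
  have h1 := h.inner_eq x _ (h.mem y)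
  have h2 := h.inner_eq y _ (h.mem x)
  simp only [inner_sub_left] at h1 h2
  rw [real_inner_comm (J x) (J y), real_inner_comm (R x) (R y)] at h2
  rw [real_inner_comm]
  linarith

theorem norm_sq_eq (z : H) : ‖R z‖ ^ 2 = ⟪z - J z, J z⟫ := by
  rw [h.inner_eq z _ (h.mem z), real_inner_self_eq_norm_sq]

theorem inner_nonneg (z : H) : 0 ≤ ⟪J z, z⟫ := by
  have h1 := h.norm_sq_eq z
  rw [inner_sub_left, real_inner_self_eq_norm_sq, real_inner_comm] at h1
  nlinarith [sq_nonneg ‖R z‖, sq_nonneg ‖J z‖]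

/-- The hypothesis `hd` says that the domain of D is dense. If Jz = 0 then Rz = 0 as well, so z is
orthogonal to the domain. -/
theorem eq_zero (hd : ∀ z : H, (∀ p ∈ G, ⟪z, p.1⟫ = 0) → z = 0) {z : H} (hz : J z = 0) :
    z = 0 := by
  have h1 := h.norm_sq_eq z
  rw [hz, inner_zero_right] at h1
  have h2 : R z = 0 := norm_eq_zero.1 (pow_eq_zero_iff two_ne_zero |>.1 h1)
  refine hd z fun p hp => ?_
  have := h.inner_eq z p hp
  rwa [hz, sub_zero, h2, inner_zero_left] at this

/-- The pairs `(u, -D*D u)` are exactly the pairs `(J z, J z - z)`. -/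
theorem eq_apply {u f : H} {g : K} (hu : (u, g) ∈ G) (hf : ∀ p ∈ G, ⟪g, p.2⟫ = -⟪f, p.1⟫) :
    u = J (u - f) := by
  set z := u - f with hz
  have hmem : (u - J z, g - R z) ∈ G := G.sub_mem hu (h.mem z)
  have h1 := h.inner_eq z _ hmem
  have h2 := hf _ hmem
  simp only at h1 h2
  -- The difference of (u, g) and (Jz, Rz) lies in G and satisfies the homogeneous equation, so
  -- testing it against itself gives zero.
  have h3 : ‖u - J z‖ ^ 2 + ‖g - R z‖ ^ 2 = 0 := by
    rw [← real_inner_self_eq_norm_sq, ← real_inner_self_eq_norm_sq, inner_sub_left g, ← h1, h2]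
    have : u - J z = (z - J z) + f := by rw [hz]; abel
    nth_rw 1 [this]
    rw [inner_add_left]
    ring
  have h4 : ‖u - J z‖ ^ 2 = 0 := by nlinarith [sq_nonneg ‖u - J z‖, sq_nonneg ‖g - R z‖]
  exact sub_eq_zero.1 (norm_eq_zero.1 (pow_eq_zero_iff two_ne_zero |>.1 h4))

/-- Firm nonexpansiveness is the identity ‖x - Jx‖² = ⟨x - Jx, x⟩ - ‖Rx‖². -/
theorem isResolventComplement (hd : ∀ z : H, (∀ p ∈ G, ⟪z, p.1⟫ = 0) → z = 0) :
    IsResolventComplement (1 - J) where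
  symm x y := by
    simp only [sub_apply, one_apply_eq_self, inner_sub_left, inner_sub_right, h.symm]
  norm_sq_le x := by
    have h1 := h.norm_sq_eq x
    simp only [sub_apply, one_apply_eq_self]
    rw [← real_inner_self_eq_norm_sq (x - J x), inner_sub_right (x - J x) x (J x)]
    nlinarith [sq_nonneg ‖R x‖]
  eq_zero x hx := by
    refine h.eq_zero hd ?_
    simpa using hx

end IsGraphResolvent

end GraphResolvent

/-! ### Uniqueness of weak solutions -/

section Uniqueness

variable {H : Type*} [NormedAddCommGroup H] [InnerProductSpace ℝ H] [CompleteSpace H]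

/-- Weak solutions of `z' = λ z - J⁻¹ z`, `z(0) = 0`, tested against the range of `J`, vanish. -/
theorem eqOn_zero_of_weak {J : H →L[ℝ] H} (hsymm : ∀ x y, ⟪J x, y⟫ = ⟪x, J y⟫)
    (hnonneg : ∀ x, 0 ≤ ⟪J x, x⟫) (hinj : ∀ x, J x = 0 → x = 0) {T : ℝ} (hT : 0 ≤ T)
    {z : ℝ → H} (hz : ContinuousOn z (Icc 0 T)) (h0 : z 0 = 0) (c : ℝ)
    (hw : ∀ ψ, AbsolutelyContinuousOnInterval (fun t => ⟪z t, J ψ⟫) 0 T ∧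
      ∀ᵐ t ∂volume.restrict (Ioo 0 T), HasDerivAt (fun s => ⟪z s, J ψ⟫) ⟪z t, c • J ψ - ψ⟫ t) :
    ∀ t ∈ Icc 0 T, z t = 0 := by
  -- Extending z continuously to the whole line makes its primitives differentiable everywhere.
  set y : ℝ → H := IccExtend hT ((Icc 0 T).domRestrict z) with hy
  have hyc : Continuous y := continuousOn_iff_continuous_domRestrict.1 hz |>.Icc_extend'
  have hyz : ∀ t ∈ Icc 0 T, y t = z t := fun t ht => by
    rw [hy, IccExtend_of_mem hT _ ht]; rfl
  have hFc : Continuous fun s => c • J (y s) - y s :=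
    ((J.continuous.comp hyc).const_smul c).sub hyc
  set w : ℝ → H := fun t => ∫ s in (0 : ℝ)..t, (c • J (y s) - y s) with hwdef
  have hwd : ∀ t, HasDerivAt w (c • J (y t) - y t) t := fun t => by
    exact (hFc.integral_hasStrictDerivAt 0 t).hasDerivAt
  -- The weak equation, integrated in time, says that J z is the primitive of c J z - z. Thus J z is
  -- differentiable although z need not be.
  have hwJ : ∀ t ∈ Icc 0 T, w t = J (y t) := by
    intro t ht
    refine ext_inner_right ℝ fun ψ => ?_
    obtain ⟨hac, had⟩ := hw ψ
    have hac' : AbsolutelyContinuousOnInterval (fun t => ⟪z t, J ψ⟫) 0 t := by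
      refine hac.mono ?_
      rw [uIcc_of_le ht.1, uIcc_of_le hT]
      exact Icc_subset_Icc_right ht.2
    have h1 := hac'.integral_deriv_eq_sub
    have h2 : ∫ s in (0 : ℝ)..t, deriv (fun t => ⟪z t, J ψ⟫) s =
        ∫ s in (0 : ℝ)..t, ⟪c • J (y s) - y s, ψ⟫ := by
      rw [intervalIntegral.integral_of_le ht.1, intervalIntegral.integral_of_le ht.1,
        integral_Ioc_eq_integral_Ioo, integral_Ioc_eq_integral_Ioo]
      refine integral_congr_ae ?_
      filter_upwards [ae_restrict_of_ae_restrict_of_subset (Ioo_subset_Ioo_right ht.2) had,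
        ae_restrict_mem measurableSet_Ioo] with s hs hs'
      rw [hs.deriv, ← hyz s ⟨hs'.1.le, hs'.2.le.trans ht.2⟩, inner_sub_left, inner_sub_right,
        inner_smul_left, inner_smul_right, hsymm]
      rfl
    have h3 : ⟪w t, ψ⟫ = ∫ s in (0 : ℝ)..t, ⟪c • J (y s) - y s, ψ⟫ := by
      have := ((innerSL ℝ ψ).intervalIntegral_comp_comm (μ := volume) (hFc.intervalIntegrable 0 t)).symm
      simp only [innerSL_apply_apply] at this
      rw [real_inner_comm, hwdef]
      simp only [this, real_inner_comm]
    rw [h3, ← h2, h1, h0, inner_zero_left, sub_zero, hsymm, hyz t ht]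
  -- The factor removes the growth due to c; what remains of the derivative is -2 exp(-2ct)⟨Jy, y⟩ ≤
  -- 0.
  set m : ℝ → ℝ := fun t => Real.exp (-(2 * c) * t) * ‖w t‖ ^ 2 with hm
  have hmd : ∀ t, HasDerivAt m (Real.exp (-(2 * c) * t) * (-(2 * c)) * ‖w t‖ ^ 2 +
      Real.exp (-(2 * c) * t) * (2 * ⟪w t, c • J (y t) - y t⟫)) t := fun t => by
    have h1 : HasDerivAt (fun t : ℝ => -(2 * c) * t) (-(2 * c)) t := by
      simpa using (hasDerivAt_id t).const_mul (-(2 * c))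
    exact h1.exp.mul (hwd t).norm_sq
  have hanti : AntitoneOn m (Icc 0 T) := by
    refine antitoneOn_of_deriv_nonpos (convex_Icc 0 T)
      (fun t _ => (hmd t).continuousAt.continuousWithinAt)
      (fun t _ => (hmd t).differentiableAt.differentiableWithinAt) fun t ht => ?_
    rw [interior_Icc] at ht
    rw [(hmd t).deriv, ← hwJ t (Ioo_subset_Icc_self ht), inner_sub_right, inner_smul_right,
      real_inner_self_eq_norm_sq]
    have h1 := hnonneg (y t)
    rw [← hwJ t (Ioo_subset_Icc_self ht)] at h1
    have h2 := mul_nonneg (Real.exp_pos (-(2 * c) * t)).le h1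
    nlinarith
  intro t ht
  have h1 := hanti ⟨le_rfl, hT⟩ ht ht.1
  have hw0 : w 0 = 0 := by simp [hwdef]
  have h2 : m 0 = 0 := by simp [hm, hw0]
  rw [h2] at h1
  have h3 : ‖w t‖ ^ 2 ≤ 0 := by
    by_contra! h
    exact absurd h1 (not_le.2 (mul_pos (Real.exp_pos _) h))
  have h4 : w t = 0 := norm_eq_zero.1
    (pow_eq_zero_iff two_ne_zero |>.1 (le_antisymm h3 (sq_nonneg _)))
  rw [← hyz t ht]
  exact hinj _ ((hwJ t ht).symm.trans h4)

end Uniqueness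

/-! ### Long-time limit of the semigroup -/

section LongTime

variable {H : Type*} [NormedAddCommGroup H] [InnerProductSpace ℝ H] [CompleteSpace H]

theorem IsSemigroupOf.apply_eq_self {C : H →L[ℝ] H} {S : ℝ → H →L[ℝ] H} (hS : IsSemigroupOf C S)
    {φ : H} (hφ : C φ = 0) {t : ℝ} (ht : 0 ≤ t) : S t φ = φ := by
  have hd : ∀ s ∈ Ioo 0 t, HasDerivAt (fun s => S s φ) 0 s := fun s hs => by
    simpa [hφ] using hS.hasDerivAt s hs.1 φ
  have h2 : ∀ s ∈ Icc 0 t, S s φ = S 0 φ := by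
    refine constant_of_has_deriv_right_zero
      ((hS.continuousOn φ).mono Icc_subset_Ici_self) fun s hs => ?_
    rcases hs.1.eq_or_lt with rfl | h
    -- The generator equation is available only for positive times, so the right derivative at 0 is
    -- obtained as a limit of derivatives.
    · refine hasDerivWithinAt_Ici_of_tendsto_deriv (s := Ioo 0 t) ?_ ?_ (Ioo_mem_nhdsGT hs.2) ?_
      · exact fun s hs => (hd s hs).differentiableAt.differentiableWithinAt
      · exact ((hS.continuousOn φ) 0 self_mem_Ici).mono fun s hs => hs.1.le
      · refine tendsto_const_nhds.congr' ?_
        filter_upwards [Ioo_mem_nhdsGT hs.2] with r hr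
        exact (hd r hr).deriv.symm
    · exact (hd s ⟨h, hs.2⟩).hasDerivWithinAt
  rw [h2 t ⟨ht, le_rfl⟩, hS.zero]

/-- Since ⟨S(t)x, x⟩ = ‖S(t/2)x‖² is nonincreasing and bounded below, S(t)x is Cauchy, exactly as
for the powers of C. The limit is the orthogonal projection of x on the kernel of C. -/
theorem IsSemigroupOf.exists_tendsto {C : H →L[ℝ] H} {S : ℝ → H →L[ℝ] H}
    (hS : IsSemigroupOf C S) (x : H) :
    ∃ y, Tendsto (fun t => S t x) atTop (𝓝 y) ∧ C y = 0 ∧ ∀ φ, C φ = 0 → ⟪y, φ⟫ = ⟪x, φ⟫ := by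
  have hinner : ∀ s t, 0 ≤ s → 0 ≤ t → ⟪S s x, S t x⟫ = ⟪S (s + t) x, x⟫ := fun s t hs ht => by
    rw [add_comm, hS.add t s ht hs, hS.symm t ht]
  -- `S` is controlled only at nonnegative times, whence the truncation.
  have hanti : Antitone fun t : ℝ => ⟪S (max t 0) x, x⟫ := by
    intro s t hst
    have h1 : ∀ r : ℝ, ⟪S (max r 0) x, x⟫ = ‖S (max r 0 / 2) x‖ ^ 2 := fun r => by
      have h0 : 0 ≤ max r 0 / 2 := by positivity
      rw [← real_inner_self_eq_norm_sq, hinner _ _ h0 h0, add_halves]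
    simp only [h1]
    refine pow_le_pow_left₀ (norm_nonneg _) ?_ 2
    have h2 : max s 0 ≤ max t 0 := max_le_max_right 0 hst
    rw [show max t 0 / 2 = (max t 0 / 2 - max s 0 / 2) + max s 0 / 2 by ring,
      hS.add _ _ (by linarith) (by positivity)]
    exact hS.norm_le _ (by linarith) _
  have hlim := tendsto_atTop_ciInf hanti ⟨0, by
    rintro _ ⟨t, rfl⟩
    have h0 : 0 ≤ max t 0 / 2 := by positivity
    have := hinner _ _ h0 h0
    rw [add_halves, real_inner_self_eq_norm_sq] at this
    simp only [← this]
    positivity⟩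
  obtain ⟨y, hy⟩ := exists_tendsto_of_norm_sub_sq (u := fun t => S t x) hlim fun i j hi hj => by
    rw [norm_sub_sq_real, ← real_inner_self_eq_norm_sq, ← real_inner_self_eq_norm_sq,
      hinner _ _ hi hi, hinner _ _ hi hj, hinner _ _ hj hj, max_eq_left (add_nonneg hi hi),
      max_eq_left (add_nonneg hi hj), max_eq_left (add_nonneg hj hj)]
  have hfix : ∀ s, 0 ≤ s → S s y = y := by
    intro s hs
    have h1 : Tendsto (fun t => S s (S t x)) atTop (𝓝 (S s y)) :=
      ((S s).continuous.tendsto y).comp hy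
    have h2 : Tendsto (fun t => S (s + t) x) atTop (𝓝 y) :=
      hy.comp (tendsto_atTop_add_const_left _ s tendsto_id)
    refine tendsto_nhds_unique (h1.congr' ?_) h2
    filter_upwards [eventually_ge_atTop 0] with t ht
    exact (hS.add s t hs ht x).symm
  refine ⟨y, hy, ?_, fun φ hφ => ?_⟩
  -- Since S fixes y, the orbit of y - Cy is constant; its derivative is -Cy, so Cy = 0.
  · have h1 := hS.hasDerivAt 1 one_pos y
    have h2 : HasDerivAt (fun s => S s (y - C y)) 0 1 := by
      refine (hasDerivAt_const (1 : ℝ) (y - C y)).congr_of_eventuallyEq ?_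
      filter_upwards [lt_mem_nhds (zero_lt_one' ℝ)] with s hs
      rw [map_sub, hS.comm s hs.le, hfix s hs.le]
    have h3 := h1.unique h2
    rwa [neg_eq_zero, hS.comm 1 zero_le_one, hfix 1 zero_le_one] at h3
  · refine tendsto_nhds_unique (hy.inner tendsto_const_nhds) (tendsto_const_nhds.congr' ?_)
    filter_upwards [eventually_ge_atTop 0] with t ht
    rw [hS.symm t ht, hS.apply_eq_self hφ ht]

end LongTime

/-! ### The semigroup satisfies the weak equation -/

section WeakForm

variable {H : Type*} [NormedAddCommGroup H] [InnerProductSpace ℝ H] [CompleteSpace H]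

theorem absolutelyContinuousOnInterval_of_hasDerivAt {f f' : ℝ → ℝ} {a b M : ℝ} (hab : a ≤ b)
    (hf : ContinuousOn f (Icc a b)) (hd : ∀ t ∈ Ioo a b, HasDerivAt f (f' t) t)
    (hM : ∀ t ∈ Ioo a b, |f' t| ≤ M) : AbsolutelyContinuousOnInterval f a b := by
  rcases hab.eq_or_lt with rfl | hlt
  · have : LipschitzOnWith 0 f (uIcc a a) := by
      intro x hx y hy
      simp only [uIcc_self, mem_singleton_iff] at hx hy
      simp [hx, hy]
    exact this.absolutelyContinuousOnInterval
  have h1 : LipschitzOnWith M.toNNReal f (Ioo a b) :=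
    (convex_Ioo a b).lipschitzOnWith_of_nnnorm_hasDerivWithin_le
      (fun t ht => (hd t ht).hasDerivWithinAt) fun t ht => by
        rw [← NNReal.coe_le_coe, coe_nnnorm, Real.norm_eq_abs]
        exact (hM t ht).trans (Real.le_coe_toNNReal M)
  have h2 := h1.closure (by rwa [closure_Ioo hlt.ne])
  rw [closure_Ioo hlt.ne, ← uIcc_of_le hab] at h2
  exact h2.absolutelyContinuousOnInterval

/-- The vectors ψ - Cψ form the domain of the generator, which sends them to -Cψ. Symmetry moves
S(t) onto the test vector, where it can be differentiated. -/
theorem IsSemigroupOf.weak_form {C : H →L[ℝ] H} {S : ℝ → H →L[ℝ] H} (hS : IsSemigroupOf C S)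
    (x ψ : H) (δ : ℝ) {T : ℝ} (hT : 0 ≤ T) :
    AbsolutelyContinuousOnInterval (fun t => ⟪Real.exp (δ * t) • S t x, ψ - C ψ⟫) 0 T ∧
    ∀ t ∈ Ioo 0 T, HasDerivAt (fun t => ⟪Real.exp (δ * t) • S t x, ψ - C ψ⟫)
      ⟪Real.exp (δ * t) • S t x, δ • (ψ - C ψ) - C ψ⟫ t := by
  have hd : ∀ t ∈ Ioo 0 T, HasDerivAt (fun t => ⟪Real.exp (δ * t) • S t x, ψ - C ψ⟫)
      ⟪Real.exp (δ * t) • S t x, δ • (ψ - C ψ) - C ψ⟫ t := by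
    intro t ht
    have h1 : HasDerivAt (fun s => ⟪S s x, ψ - C ψ⟫) ⟪S t x, -C ψ⟫ t := by
      have h2 := (hasDerivAt_const t x).inner ℝ (hS.hasDerivAt t ht.1 ψ)
      simp only [inner_zero_left, add_zero] at h2
      rw [inner_neg_right, ← hS.symm t ht.1.le, ← inner_neg_right] at h2
      refine h2.congr_of_eventuallyEq ?_
      filter_upwards [lt_mem_nhds ht.1] with s hs
      exact hS.symm s hs.le _ _
    have h3 : HasDerivAt (fun t : ℝ => Real.exp (δ * t)) (Real.exp (δ * t) * δ) t := by
      have : HasDerivAt (fun t : ℝ => δ * t) δ t := by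
        simpa using (hasDerivAt_id t).const_mul δ
      exact this.exp
    have h4 := h3.mul h1
    simp only [real_inner_smul_left]
    refine h4.congr_deriv ?_
    rw [inner_sub_right _ (δ • (ψ - C ψ)), inner_smul_right, inner_neg_right]
    ring
  have hc : ContinuousOn (fun t => Real.exp (δ * t) • S t x) (Icc 0 T) :=
    (by fun_prop : Continuous fun t : ℝ => Real.exp (δ * t)).continuousOn.smul
      ((hS.continuousOn x).mono Icc_subset_Ici_self)
  obtain ⟨M, hM⟩ := isCompact_Icc.exists_bound_of_continuousOn
    (hc.inner (𝕜 := ℝ) (continuousOn_const (c := δ • (ψ - C ψ) - C ψ)))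
  exact ⟨absolutelyContinuousOnInterval_of_hasDerivAt hT (hc.inner continuousOn_const) hd
    fun t ht => hM t (Ioo_subset_Icc_self ht), hd⟩

end WeakForm

/-! ### Square integrability in time of D S(t)x -/

section Energy

variable {H K : Type*} [NormedAddCommGroup H] [InnerProductSpace ℝ H] [CompleteSpace H]
  [NormedAddCommGroup K] [InnerProductSpace ℝ K] [CompleteSpace K]

variable {G : Submodule ℝ (H × K)} {J : H →L[ℝ] H} {R : H →L[ℝ] K} {S : ℝ → H →L[ℝ] H}

theorem IsSemigroupOf.memLp_comp (hS : IsSemigroupOf (1 - J) S) (R : H →L[ℝ] K) (T : ℝ) (y : H) :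
    MemLp (fun t => R (S t y)) 2 (volume.restrict (Ioo 0 T)) := by
  refine MemLp.of_bound (C := ‖R‖ * ‖y‖) ?_ ?_
  · refine ContinuousOn.aestronglyMeasurable ?_ measurableSet_Ioo
    exact R.continuous.comp_continuousOn ((hS.continuousOn y).mono fun t ht => ht.1.le)
  · filter_upwards [ae_restrict_mem measurableSet_Ioo] with t ht
    exact (R.le_opNorm _).trans (by gcongr; exact hS.norm_le t ht.1.le y)

/-- Energy identity: ‖R S(t)y‖² is the derivative of -½‖S(t)Jy‖². The bound involves only ‖Jy‖, so
it extends to all initial data by density of the range of J. -/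
theorem IsSemigroupOf.norm_toLp_le (hS : IsSemigroupOf (1 - J) S) (h : IsGraphResolvent G J R)
    {T : ℝ} (hT : 0 ≤ T) (y : H) : ‖(hS.memLp_comp R T y).toLp‖ ≤ ‖J y‖ := by
  refine (sq_le_sq₀ (norm_nonneg _) (norm_nonneg _)).1 ?_
  have h1 : ‖(hS.memLp_comp R T y).toLp‖ ^ 2 = ∫ t in (0 : ℝ)..T, ‖R (S t y)‖ ^ 2 := by
    rw [← real_inner_self_eq_norm_sq, L2.inner_def, intervalIntegral.integral_of_le hT,
      integral_Ioc_eq_integral_Ioo]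
    refine integral_congr_ae ?_
    filter_upwards [(hS.memLp_comp R T y).coeFn_toLp] with t ht
    rw [ht, real_inner_self_eq_norm_sq]
  have hJ : ∀ z, z - (1 - J) z = J z := fun z => by simp
  have hcomm : ∀ t, 0 ≤ t → ∀ z, S t (J z) = J (S t z) := fun t ht z => by
    have := hS.comm t ht z
    simpa using this
  have hcont : ContinuousOn (fun t => S t (J y)) (Icc 0 T) :=
    (hS.continuousOn (J y)).mono Icc_subset_Ici_self
  have h2 := intervalIntegral.integral_eq_sub_of_hasDerivAt_of_le hT
    (f := fun t => -(1 / 2) * ‖S t (J y)‖ ^ 2) (f' := fun t => ‖R (S t y)‖ ^ 2)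
    (continuousOn_const.mul (hcont.norm.pow 2)) (fun t ht => by
      have h3 := hS.hasDerivAt t ht.1 y
      rw [hJ] at h3
      refine (h3.norm_sq.const_mul (-(1 / 2))).congr_deriv ?_
      rw [h.norm_sq_eq, sub_apply, one_apply_eq_self, map_sub, hcomm t ht.1.le, inner_neg_right,
        real_inner_comm]
      ring) (by
      refine ContinuousOn.intervalIntegrable ?_
      rw [uIcc_of_le hT]
      exact (R.continuous.comp_continuousOn
        ((hS.continuousOn y).mono Icc_subset_Ici_self)).norm.pow 2)
  rw [h1, h2, hS.zero]
  nlinarith [sq_nonneg ‖S T (J y)‖, sq_nonneg ‖J y‖]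

/-- Along the semigroup, `D S(t) x` is square integrable in time. -/
theorem IsSemigroupOf.exists_energy (hS : IsSemigroupOf (1 - J) S) (h : IsGraphResolvent G J R)
    (hG : IsClosed (G : Set (H × K))) (hd : ∀ z : H, (∀ p ∈ G, ⟪z, p.1⟫ = 0) → z = 0)
    {T : ℝ} (hT : 0 ≤ T) (x : H) :
    ∃ g : ℝ → K, MemLp g 2 (volume.restrict (Ioo 0 T)) ∧
      ∀ᵐ t ∂volume.restrict (Ioo 0 T), (S t x, g t) ∈ G := by
  have hJ : ∀ z, z - (1 - J) z = J z := fun z => by simp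
  have hcomm : ∀ t, 0 ≤ t → ∀ z, S t (J z) = J (S t z) := fun t ht z => by
    have := hS.comm t ht z
    simpa using this
  have hdense : DenseRange J := by
    have := (h.isResolventComplement hd).denseRange
    simpa only [hJ] using this
  obtain ⟨u, hu, hux⟩ := mem_closure_iff_seq_limit.1 (hdense x)
  choose y hy using hu
  have hyx : Tendsto (fun n => J (y n)) atTop (𝓝 x) := by simpa only [hy] using hux
  -- The functions R S(t)yₙ = D S(t)Jyₙ are Cauchy in L²(0,T;K). Along an a.e. convergent
  -- subsequence, closedness of the graph identifies the limit.
  have hcs : CauchySeq fun n => (hS.memLp_comp R T (y n)).toLp := by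
    rw [Metric.cauchySeq_iff]
    intro ε hε
    obtain ⟨N, hN⟩ := Metric.cauchySeq_iff.1 hyx.cauchySeq ε hε
    refine ⟨N, fun m hm n hn => lt_of_le_of_lt ?_ (hN m hm n hn)⟩
    rw [dist_eq_norm, dist_eq_norm, ← map_sub, ← MemLp.toLp_sub]
    refine le_trans (le_of_eq ?_) (hS.norm_toLp_le h hT (y m - y n))
    congr 1
    refine MemLp.toLp_congr _ _ (Eventually.of_forall fun t => ?_)
    simp
  obtain ⟨g, hg⟩ := cauchySeq_tendsto_of_complete hcs
  obtain ⟨ns, hns, hae⟩ := (tendstoInMeasure_of_tendsto_Lp hg).exists_seq_tendsto_ae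
  refine ⟨g, Lp.memLp g, ?_⟩
  have hall : ∀ᵐ t ∂volume.restrict (Ioo 0 T), ∀ n,
      ((hS.memLp_comp R T (y n)).toLp : ℝ → K) t = R (S t (y n)) :=
    ae_all_iff.2 fun n => (hS.memLp_comp R T (y n)).coeFn_toLp
  filter_upwards [hae, hall, ae_restrict_mem measurableSet_Ioo] with t ht ht2 ht3
  have h1 : Tendsto (fun i => S t (J (y (ns i)))) atTop (𝓝 (S t x)) :=
    (((S t).continuous.tendsto x).comp hyx).comp hns.tendsto_atTop
  refine hG.mem_of_tendsto (h1.prodMk_nhds ht) (Eventually.of_forall fun i => ?_)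
  rw [ht2, hcomm t ht3.1.le]
  exact h.mem _

end Energy

/-! ### Absolutely continuous functions on (-1,1) and their boundary values -/

section Interval

theorem LocallyAC.of_ac {W : ℝ → ℝ} (hW : AbsolutelyContinuousOnInterval W (-1) 1) :
    LocallyAC W := fun c d hc hcd hd => hW.mono (by
  rw [uIcc_of_le hcd, uIcc_of_le (by norm_num)]
  exact Icc_subset_Icc hc.le hd.le)

theorem LocallyAC.mul {U V : ℝ → ℝ} (hU : LocallyAC U) (hV : LocallyAC V) :
    LocallyAC fun x => U x * V x := fun c d hc hcd hd =>
  (hU c d hc hcd hd).fun_mul (hV c d hc hcd hd)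

theorem LocallyAC.sub {U V : ℝ → ℝ} (hU : LocallyAC U) (hV : LocallyAC V) :
    LocallyAC fun x => U x - V x := fun c d hc hcd hd =>
  (hU c d hc hcd hd).sub (hV c d hc hcd hd)

theorem LocallyAC.uIcc {U : ℝ → ℝ} (hU : LocallyAC U) {c d : ℝ} (hc : c ∈ Ioo (-1 : ℝ) 1)
    (hd : d ∈ Ioo (-1 : ℝ) 1) : AbsolutelyContinuousOnInterval U c d := by
  rcases le_total c d with h | h
  · exact hU c d hc.1 h hd.2
  · exact (hU d c hd.1 h hc.2).symm

theorem LocallyAC.integral_deriv {U : ℝ → ℝ} (hU : LocallyAC U) {c d : ℝ}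
    (hc : c ∈ Ioo (-1 : ℝ) 1) (hd : d ∈ Ioo (-1 : ℝ) 1) :
    ∫ x in c..d, deriv U x = U d - U c := (hU.uIcc hc hd).integral_deriv_eq_sub

theorem intervalIntegrable_of_integrable {f : ℝ → ℝ} (hf : Integrable f μI) :
    IntervalIntegrable f volume (-1) 1 := by
  rw [intervalIntegrable_iff_integrableOn_Ioo_of_le (by norm_num)]
  exact hf

theorem intervalIntegrable_of_integrable' {f : ℝ → ℝ} (hf : Integrable f μI) {c d : ℝ}
    (hc : c ∈ Icc (-1 : ℝ) 1) (hd : d ∈ Icc (-1 : ℝ) 1) : IntervalIntegrable f volume c d := by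
  refine (intervalIntegrable_of_integrable hf).mono_set ?_
  rw [uIcc_of_le (show (-1 : ℝ) ≤ 1 by norm_num)]
  exact uIcc_subset_Icc hc hd

theorem integral_μI (f : ℝ → ℝ) : ∫ x, f x ∂μI = ∫ x in (-1 : ℝ)..1, f x := by
  rw [intervalIntegral.integral_of_le (by norm_num), integral_Ioc_eq_integral_Ioo]

theorem ae_uIoc_of_ae {P : ℝ → Prop} (h : ∀ᵐ x ∂μI, P x) {c d : ℝ}
    (hc : c ∈ Icc (-1 : ℝ) 1) (hd : d ∈ Icc (-1 : ℝ) 1) :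
    ∀ᵐ x, x ∈ uIoc c d → P x := by
  rw [ae_restrict_iff' measurableSet_Ioo] at h
  have h1 : ∀ᵐ x : ℝ, x ≠ 1 := by simp [ae_iff, measure_singleton]
  filter_upwards [h, h1] with x hx hx1 hxm
  refine hx ⟨lt_of_le_of_lt (le_min hc.1 hd.1) hxm.1,
    lt_of_le_of_ne (hxm.2.trans (max_le hc.2 hd.2)) hx1⟩

/-- The antiderivative of an integrable function on `(-1, 1)`. -/
theorem ac_integral {f : ℝ → ℝ} (hf : Integrable f μI) :
    AbsolutelyContinuousOnInterval (fun x => ∫ t in (-1 : ℝ)..x, f t) (-1) 1 :=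
  (intervalIntegrable_of_integrable hf).absolutelyContinuousOnInterval_intervalIntegral (by simp)

theorem deriv_integral_ae {f : ℝ → ℝ} (hf : Integrable f μI) :
    deriv (fun x => ∫ t in (-1 : ℝ)..x, f t) =ᵐ[μI] f := by
  refine (ae_restrict_iff' measurableSet_Ioo).2 ?_
  filter_upwards [(intervalIntegrable_of_integrable hf).ae_hasDerivAt_integral] with x hx hxI
  refine (hx ?_ (-1) (by simp)).deriv
  rw [uIcc_of_le (by norm_num)]
  exact Ioo_subset_Icc_self hxI

/-- If `F` has a limit at an endpoint `e = ±1` and `|F| ≤ η + (1 - |x|) k` with `k` integrable, for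
each `η > 0`, then the limit is zero. -/
theorem limit_eq_zero_of_small {F : ℝ → ℝ} {e ℓ : ℝ} (he : e = -1 ∨ e = 1)
    (hlim : Tendsto F (𝓝[Ioo (-1) 1] e) (𝓝 ℓ))
    (hsmall : ∀ η > 0, ∃ k, Integrable k μI ∧ ∀ᵐ x ∂μI, |F x| ≤ η + (1 - |x|) * k x) : ℓ = 0 := by
  by_contra hℓ
  have hℓ' : 0 < |ℓ| := abs_pos.2 hℓ
  -- Near e one has |F| > |ℓ|/2, so the bound with η = |ℓ|/4 gives 1/|x - e| ≤ (4/|ℓ|)|k|,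
  -- contradicting the non-integrability of 1/(x - e).
  obtain ⟨k, hk, hFk⟩ := hsmall (|ℓ| / 4) (by positivity)
  have hev : ∀ᶠ x in 𝓝[Ioo (-1) 1] e, |ℓ| / 2 < |F x| :=
    hlim.abs.eventually (lt_mem_nhds (by linarith))
  obtain ⟨s, hs, hsub⟩ := Metric.mem_nhdsWithin_iff.1 hev
  have hint : IntegrableOn (fun x => (x - e)⁻¹) (Metric.ball e s ∩ Ioo (-1) 1) := by
    have hms : MeasurableSet (Metric.ball e s ∩ Ioo (-1 : ℝ) 1) :=
      Metric.isOpen_ball.measurableSet.inter measurableSet_Ioo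
    have hki : IntegrableOn k (Metric.ball e s ∩ Ioo (-1) 1) :=
      IntegrableOn.mono_set hk inter_subset_right
    refine (hki.norm.const_mul (4 / |ℓ|)).mono' (by fun_prop) ?_
    rw [ae_restrict_iff' measurableSet_Ioo] at hFk
    rw [ae_restrict_iff' hms]
    filter_upwards [hFk] with x hx hxm
    have h1 := hx hxm.2
    have h2 : |ℓ| / 2 < |F x| := hsub hxm
    have h3 : 1 - |x| ≤ |x - e| := by
      have h4 : |e| = 1 := by rcases he with rfl | rfl <;> simp
      rw [← h4, abs_sub_comm]
      exact abs_sub_abs_le_abs_sub _ _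
    have h5 : 0 < 1 - |x| := sub_pos.2 (abs_lt.2 hxm.2)
    have h6 : (1 - |x|) * k x ≤ |x - e| * |k x| :=
      mul_le_mul h3 (le_abs_self _) (by
        by_contra! h; nlinarith [mul_neg_of_pos_of_neg h5 h]) (abs_nonneg _)
    have h7 : |ℓ| / 4 ≤ |x - e| * |k x| := by linarith
    have h8 : 0 < |x - e| := h5.trans_le h3
    rw [norm_inv, Real.norm_eq_abs, Real.norm_eq_abs, inv_le_iff_one_le_mul₀ h8]
    calc (1 : ℝ) = 4 / |ℓ| * (|ℓ| / 4) := by field_simp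
      _ ≤ 4 / |ℓ| * (|x - e| * |k x|) := by gcongr
      _ = _ := by ring
  rcases he with rfl | rfl
  · have h1 : IntervalIntegrable (fun x : ℝ => (x - -1)⁻¹) volume (-1) (min (-1 + s) 1) := by
      rw [intervalIntegrable_iff_integrableOn_Ioo_of_le (le_min (by linarith) (by norm_num))]
      refine hint.mono_set fun x hx => ?_
      have h2 := hx.2.trans_le (min_le_left _ _)
      refine ⟨?_, hx.1, hx.2.trans_le (min_le_right _ _)⟩
      rw [Metric.mem_ball, Real.dist_eq, abs_lt]
      constructor <;> linarith [hx.1]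
    rw [intervalIntegrable_sub_inv_iff] at h1
    rcases h1 with h1 | h1
    · exact absurd h1 (ne_of_lt (lt_min (by linarith) (by norm_num)))
    · exact h1 left_mem_uIcc
  · have h1 : IntervalIntegrable (fun x : ℝ => (x - 1)⁻¹) volume (max (1 - s) (-1)) 1 := by
      rw [intervalIntegrable_iff_integrableOn_Ioo_of_le (max_le (by linarith) (by norm_num))]
      refine hint.mono_set fun x hx => ?_
      have h2 := (le_max_left _ _).trans_lt hx.1
      refine ⟨?_, (le_max_right _ _).trans_lt hx.1, hx.2⟩
      rw [Metric.mem_ball, Real.dist_eq, abs_lt]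
      constructor <;> linarith [hx.2]
    rw [intervalIntegrable_sub_inv_iff] at h1
    rcases h1 with h1 | h1
    · exact absurd h1 (ne_of_lt (max_lt (by linarith) (by norm_num)))
    · exact h1 right_mem_uIcc

/-- A locally absolutely continuous function on `(-1, 1)` with integrable derivative which is small
near the endpoints extends to an absolutely continuous function vanishing at `±1`. -/
theorem LocallyAC.exists_extension {F : ℝ → ℝ} (hF : LocallyAC F) (hint : Integrable (deriv F) μI)
    (hsmall : ∀ η > 0, ∃ k, Integrable k μI ∧ ∀ᵐ x ∂μI, |F x| ≤ η + (1 - |x|) * k x) :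
    ∃ P : ℝ → ℝ, EqOn P F (Ioo (-1) 1) ∧ AbsolutelyContinuousOnInterval P (-1) 1 ∧
      P (-1) = 0 ∧ P 1 = 0 := by
  set P : ℝ → ℝ := fun x => ∫ t in (-1 : ℝ)..x, deriv F t with hP
  have hac : AbsolutelyContinuousOnInterval P (-1) 1 := ac_integral hint
  have h00 : (0 : ℝ) ∈ Ioo (-1 : ℝ) 1 := by norm_num
  have hFP : ∀ x ∈ Ioo (-1 : ℝ) 1, F x = P x + (F 0 - P 0) := by
    intro x hx
    have h1 := hF.integral_deriv h00 hx
    have h2 := intervalIntegral.integral_interval_sub_left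
      (intervalIntegrable_of_integrable' hint (left_mem_Icc.2 (by norm_num)) (Ioo_subset_Icc_self hx))
      (intervalIntegrable_of_integrable' hint (left_mem_Icc.2 (by norm_num)) (Ioo_subset_Icc_self h00))
    simp only [hP]
    linarith
  have hPc : ContinuousOn P (Icc (-1) 1) := by
    have := hac.continuousOn
    rwa [uIcc_of_le (by norm_num)] at this
  have hlim : ∀ e ∈ Icc (-1 : ℝ) 1, Tendsto F (𝓝[Ioo (-1) 1] e) (𝓝 (P e + (F 0 - P 0))) := by
    intro e he
    have h1 : Tendsto P (𝓝[Ioo (-1) 1] e) (𝓝 (P e)) :=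
      (hPc e he).mono_left (nhdsWithin_mono _ Ioo_subset_Icc_self)
    refine (h1.add_const (F 0 - P 0)).congr' ?_
    filter_upwards [self_mem_nhdsWithin] with x hx using (hFP x hx).symm
  have hl := limit_eq_zero_of_small (Or.inl rfl) (hlim (-1) (by norm_num)) hsmall
  have hr := limit_eq_zero_of_small (Or.inr rfl) (hlim 1 (by norm_num)) hsmall
  have hP0 : P (-1) = 0 := by simp [hP]
  rw [hP0, zero_add] at hl
  rw [hl, add_zero] at hr
  refine ⟨P, fun x hx => ?_, hac, hP0, hr⟩
  rw [hFP x hx, hl, add_zero]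

theorem LocallyAC.integral_deriv_eq_zero {F : ℝ → ℝ} (hF : LocallyAC F)
    (hint : Integrable (deriv F) μI)
    (hsmall : ∀ η > 0, ∃ k, Integrable k μI ∧ ∀ᵐ x ∂μI, |F x| ≤ η + (1 - |x|) * k x) :
    ∫ x, deriv F x ∂μI = 0 := by
  obtain ⟨P, hPF, hP, h0, h1⟩ := hF.exists_extension hint hsmall
  have h2 : deriv F =ᵐ[μI] deriv P := by
    filter_upwards [ae_restrict_mem measurableSet_Ioo] with x hx
    exact (Filter.eventuallyEq_of_mem (isOpen_Ioo.mem_nhds hx) hPF).deriv_eq.symm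
  rw [integral_congr_ae h2, integral_μI, hP.integral_deriv_eq_sub, h0, h1, sub_zero]

theorem LocallyAC.eq_of_deriv_zero {F : ℝ → ℝ} (hF : LocallyAC F) (h : deriv F =ᵐ[μI] 0) {x : ℝ}
    (hx : x ∈ Ioo (-1 : ℝ) 1) : F x = F 0 := by
  have h1 := hF.integral_deriv (show (0 : ℝ) ∈ Ioo (-1 : ℝ) 1 by norm_num) hx
  have h2 : ∫ t in (0 : ℝ)..x, deriv F t = ∫ t in (0 : ℝ)..x, (0 : ℝ) :=
    intervalIntegral.integral_congr_ae (ae_uIoc_of_ae h (by norm_num) (Ioo_subset_Icc_self hx))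
  rw [h2, intervalIntegral.integral_zero] at h1
  linarith

theorem integrable_mul_L2 {f g : ℝ → ℝ} (hf : MemLp f 2 μI) (hg : MemLp g 2 μI) :
    Integrable (fun x => f x * g x) μI := hf.integrable_mul hg

theorem inner_eq_integral (u v : L2) : ⟪u, v⟫ = ∫ x, u x * v x ∂μI := by
  rw [L2.inner_def]
  simp [mul_comm]

theorem MemLp.integrable_μI {f : ℝ → ℝ} (hf : MemLp f 2 μI) : Integrable f μI :=
  hf.integrable (by norm_num)

/-- Hölder continuity of the antiderivative of an `L²` function. -/
theorem sq_integral_le (f : L2) {c d : ℝ} (hc : -1 ≤ c) (hcd : c ≤ d) (hd : d ≤ 1) :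
    (∫ t in c..d, f t) ^ 2 ≤ (d - c) * ‖f‖ ^ 2 := by
  have hm : MeasurableSet (Ioo c d) := measurableSet_Ioo
  have hfin : μI (Ioo c d) ≠ ∞ := measure_ne_top _ _
  have hμ : (μI (Ioo c d)).toReal = d - c := by
    rw [Measure.restrict_apply hm, inter_eq_left.2 (Ioo_subset_Ioo hc hd), Real.volume_Ioo,
      ENNReal.toReal_ofReal (by linarith)]
  have h1 := L2.inner_indicatorConstLp_one (𝕜 := ℝ) hm hfin f
  rw [Measure.restrict_restrict hm, inter_eq_left.2 (Ioo_subset_Ioo hc hd),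
    ← integral_Ioc_eq_integral_Ioo, ← intervalIntegral.integral_of_le hcd] at h1
  have h2 := abs_real_inner_le_norm (indicatorConstLp 2 hm hfin (1 : ℝ)) f
  have h3 : ‖indicatorConstLp 2 hm hfin (1 : ℝ)‖ ^ 2 = d - c := by
    rw [norm_indicatorConstLp (by norm_num) (by norm_num), measureReal_def, hμ]
    simp only [norm_one, one_mul, ENNReal.toReal_ofNat]
    rw [← Real.sqrt_eq_rpow, Real.sq_sqrt (by linarith)]
  rw [h1] at h2
  rw [← h3, ← mul_pow, ← sq_abs]
  exact pow_le_pow_left₀ (abs_nonneg _) h2 2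

/-- Integrate f from the endpoint nearer to x, at distance 1 - |x|, and apply Cauchy–Schwarz. -/
theorem AbsolutelyContinuousOnInterval.sq_le {W : ℝ → ℝ} {f : L2}
    (hW : AbsolutelyContinuousOnInterval W (-1) 1) (hl : W (-1) = 0) (hr : W 1 = 0)
    (hf : (f : ℝ → ℝ) =ᵐ[μI] deriv W) {x : ℝ} (hx : x ∈ Ioo (-1 : ℝ) 1) :
    W x ^ 2 ≤ (1 - |x|) * ‖f‖ ^ 2 := by
  have hx' := Ioo_subset_Icc_self hx
  have h1 : ∀ c d, c ∈ Icc (-1 : ℝ) 1 → d ∈ Icc (-1 : ℝ) 1 → ∫ t in c..d, f t = W d - W c := by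
    intro c d hc hd
    rw [← (hW.mono (c := c) (d := d) (by
      rw [uIcc_of_le (show (-1 : ℝ) ≤ 1 by norm_num)]
      exact uIcc_subset_Icc hc hd)).integral_deriv_eq_sub]
    exact intervalIntegral.integral_congr_ae (ae_uIoc_of_ae hf hc hd)
  rcases le_total 0 x with h | h
  · have h2 := sq_integral_le f hx'.1 hx'.2 le_rfl
    rw [h1 _ _ hx' (by norm_num), hr, zero_sub, neg_sq] at h2
    rwa [abs_of_nonneg h]
  · have h2 := sq_integral_le f le_rfl hx'.1 hx'.2
    rw [h1 _ _ (by norm_num) hx', hl, sub_zero] at h2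
    rw [abs_of_nonpos h]
    linarith

theorem exists_bound_Ioo {f : ℝ → ℝ} (hf : ContinuousOn f (Icc (-1) 1)) :
    ∃ M, 0 ≤ M ∧ ∀ x ∈ Ioo (-1 : ℝ) 1, |f x| ≤ M := by
  obtain ⟨M, hM⟩ := isCompact_Icc.exists_bound_of_continuousOn hf
  exact ⟨|M|, abs_nonneg _, fun x hx => (hM x (Ioo_subset_Icc_self hx)).trans (le_abs_self M)⟩

theorem memLp_top_of_bound {f : ℝ → ℝ} (hf : AEStronglyMeasurable f μI) {M : ℝ}
    (hM : ∀ x ∈ Ioo (-1 : ℝ) 1, |f x| ≤ M) (p : ℝ≥0∞) : MemLp f p μI :=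
  MemLp.of_bound hf M ((ae_restrict_iff' measurableSet_Ioo).2 (Eventually.of_forall hM))

theorem memLp_of_continuousOn {f : ℝ → ℝ} (hf : ContinuousOn f (Icc (-1) 1)) (p : ℝ≥0∞) :
    MemLp f p μI := by
  obtain ⟨M, -, hM⟩ := exists_bound_Ioo hf
  exact memLp_top_of_bound ((hf.mono Ioo_subset_Icc_self).aestronglyMeasurable measurableSet_Ioo)
    hM p

end Interval

/-! ### Polynomial approximation in L²(-1,1) -/

section Density

/-- The class in `L²(-1,1)` of a polynomial function. -/
def polyL2 (p : Polynomial ℝ) : L2 :=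
  (memLp_of_continuousOn (f := fun x => p.eval x) p.continuous.continuousOn 2).toLp

theorem coeFn_polyL2 (p : Polynomial ℝ) : (polyL2 p : ℝ → ℝ) =ᵐ[μI] fun x => p.eval x :=
  MemLp.coeFn_toLp _

theorem norm_toLp_sub_le {f g : ℝ → ℝ} (hf : MemLp f 2 μI) (hg : MemLp g 2 μI) {M : ℝ}
    (hM : 0 ≤ M) (h : ∀ x ∈ Ioo (-1 : ℝ) 1, |f x - g x| ≤ M) :
    ‖hf.toLp - hg.toLp‖ ≤ √2 * M := by
  rw [← MemLp.toLp_sub]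
  refine (Lp.norm_le_of_ae_bound hM ?_).trans (le_of_eq ?_)
  · filter_upwards [(hf.sub hg).coeFn_toLp, ae_restrict_mem measurableSet_Ioo] with x hx hxI
    rw [hx]
    exact h x hxI
  · congr 1
    rw [← NNReal.coe_rpow]
    rw [show measureUnivNNReal μI = 2 by
      simp only [measureUnivNNReal, MeasurableSet.univ, Measure.restrict_apply, univ_inter,
        Real.volume_Ioo]
      rw [show (1 : ℝ) - -1 = 2 by norm_num]
      exact Real.toNNReal_ofNat 2]
    simp [Real.sqrt_eq_rpow]

/-- A nonnegative function of `L²(-1,1)` is a limit of polynomials that are positive on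
`[-1,1]`. -/
theorem exists_pos_polyL2_near {u : L2} (hu : 0 ≤ u) {ε : ℝ} (hε : 0 < ε) :
    ∃ p : Polynomial ℝ, (∀ x ∈ Icc (-1 : ℝ) 1, 0 < p.eval x) ∧ ‖polyL2 p - u‖ < ε := by
  obtain ⟨f, hf, hfm⟩ := (Lp.memLp u).exists_boundedContinuous_eLpNorm_sub_le (by norm_num)
    (ε := ENNReal.ofReal (ε / 2)) (by simpa using hε)
  -- Taking the positive part is 1-Lipschitz and fixes u, so it does not increase the distance to u.
  set F : ℝ → ℝ := fun x => max (f x) 0 with hF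
  have hFc : Continuous F := f.continuous.max continuous_const
  have hFm : MemLp F 2 μI := memLp_of_continuousOn hFc.continuousOn 2
  have h1 : ‖hFm.toLp - u‖ ≤ ε / 2 := by
    rw [Lp.norm_def]
    refine ENNReal.toReal_le_of_le_ofReal (by positivity) (le_trans ?_ hf)
    refine eLpNorm_mono_ae ?_
    filter_upwards [hFm.coeFn_toLp, Lp.coeFn_sub hFm.toLp u, (Lp.coeFn_nonneg u).2 hu]
      with x hx hx2 hx3
    rw [hx2, Pi.sub_apply, Pi.sub_apply, hx, Real.norm_eq_abs, Real.norm_eq_abs,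
      abs_sub_comm (u x)]
    have : u x = max (u x) 0 := (max_eq_left hx3).symm
    rw [this]
    exact (abs_max_sub_max_le_abs _ _ _).trans (by rw [← this])
  -- Lifting by ε/8 before approximating within ε/8 makes p strictly positive and within ε/4 of F.
  obtain ⟨p, hp⟩ := exists_polynomial_near_of_continuousOn (-1) 1 (fun x => F x + ε / 8)
    (hFc.add continuous_const).continuousOn (ε / 8) (by positivity)
  refine ⟨p, fun x hx => ?_, ?_⟩
  · have h2 := (abs_lt.1 (hp x hx)).1
    have h3 : 0 ≤ F x := le_max_right _ _
    linarith
  · have h2 : ‖polyL2 p - hFm.toLp‖ ≤ √2 * (ε / 4) :=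
      norm_toLp_sub_le _ _ (by positivity) fun x hx => by
        have h2 := abs_lt.1 (hp x (Ioo_subset_Icc_self hx))
        rw [abs_le]
        constructor <;> linarith [h2.1, h2.2]
    have h3 : √2 < 2 := by
      rw [Real.sqrt_lt' (by norm_num)]; norm_num
    calc ‖polyL2 p - u‖ = ‖(polyL2 p - hFm.toLp) + (hFm.toLp - u)‖ := by congr 1; abel
      _ ≤ √2 * (ε / 4) + ε / 2 := (norm_add_le _ _).trans (add_le_add h2 h1)
      _ < ε := by nlinarith

theorem dense_polyL2 : Dense (range polyL2) := by
  rw [Metric.dense_iff]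
  intro u ε hε
  obtain ⟨f, hf, hfm⟩ := (Lp.memLp u).exists_boundedContinuous_eLpNorm_sub_le (by norm_num)
    (ε := ENNReal.ofReal (ε / 2)) (by simpa using hε)
  have h1 : ‖hfm.toLp - u‖ ≤ ε / 2 := by
    rw [Lp.norm_def]
    refine ENNReal.toReal_le_of_le_ofReal (by positivity) (le_trans ?_ hf)
    refine eLpNorm_mono_ae ?_
    filter_upwards [hfm.coeFn_toLp, Lp.coeFn_sub hfm.toLp u] with x hx hx2
    rw [hx2, Pi.sub_apply, Pi.sub_apply, hx, norm_sub_rev]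
  obtain ⟨p, hp⟩ := exists_polynomial_near_of_continuousOn (-1) 1 f
    f.continuous.continuousOn (ε / 8) (by positivity)
  refine ⟨polyL2 p, ?_, p, rfl⟩
  have h2 : ‖polyL2 p - hfm.toLp‖ ≤ √2 * (ε / 8) :=
    norm_toLp_sub_le _ _ (by positivity) fun x hx => (hp x (Ioo_subset_Icc_self hx)).le
  have h3 : √2 < 2 := by
    rw [Real.sqrt_lt' (by norm_num)]; norm_num
  rw [Metric.mem_ball, dist_eq_norm]
  calc ‖polyL2 p - u‖ = ‖(polyL2 p - hfm.toLp) + (hfm.toLp - u)‖ := by congr 1; abel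
    _ ≤ √2 * (ε / 8) + ε / 2 := (norm_add_le _ _).trans (add_le_add h2 h1)
    _ < ε := by nlinarith

end Density

/-! ### The weighted derivative √a u' and its closedness -/

section WeightedDeriv

/-- The standing assumptions on the diffusion coefficient. -/
structure IsDegenerateWeight (a : ℝ → ℝ) : Prop where
  smooth : ContDiffOn ℝ 1 a (Icc (-1) 1)
  pos : ∀ x ∈ Ioo (-1 : ℝ) 1, 0 < a x
  left : a (-1) = 0
  right : a 1 = 0

namespace IsDegenerateWeight

variable {a : ℝ → ℝ} (ha : IsDegenerateWeight a)
include ha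

theorem continuousOn : ContinuousOn a (Icc (-1) 1) := ha.smooth.continuousOn

theorem nonneg {x : ℝ} (hx : x ∈ Icc (-1 : ℝ) 1) : 0 ≤ a x := by
  rcases hx.1.eq_or_lt with h | h
  · rw [← h, ha.left]
  rcases hx.2.eq_or_lt with h' | h'
  · rw [h', ha.right]
  exact (ha.pos x ⟨h, h'⟩).le

theorem ac : AbsolutelyContinuousOnInterval a (-1) 1 := by
  refine ContDiffOn.absolutelyContinuousOnInterval ?_
  rw [uIcc_of_le (by norm_num)]
  exact ha.smooth

theorem differentiableAt {x : ℝ} (hx : x ∈ Ioo (-1 : ℝ) 1) : DifferentiableAt ℝ a x :=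
  (ha.smooth.differentiableOn one_ne_zero).differentiableAt (Icc_mem_nhds hx.1 hx.2)

theorem exists_deriv_bound : ∃ M, 0 ≤ M ∧ ∀ x ∈ Ioo (-1 : ℝ) 1, |deriv a x| ≤ M := by
  obtain ⟨M, hM, h⟩ := exists_bound_Ioo
    (ha.smooth.continuousOn_derivWithin (uniqueDiffOn_Icc (by norm_num)) le_rfl)
  refine ⟨M, hM, fun x hx => ?_⟩
  rw [← derivWithin_of_mem_nhds (Icc_mem_nhds hx.1 hx.2)]
  exact h x hx

/-- a is Lipschitz up to the endpoints and vanishes there. This decay is what removes the boundary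
terms in the integrations by parts. -/
theorem exists_le_dist : ∃ M, 0 ≤ M ∧ ∀ x ∈ Ioo (-1 : ℝ) 1, a x ≤ M * (1 - |x|) := by
  obtain ⟨M, hM⟩ := ha.smooth.exists_lipschitzOnWith one_ne_zero (convex_Icc _ _) isCompact_Icc
  refine ⟨M, M.2, fun x hx => ?_⟩
  have hx' := Ioo_subset_Icc_self hx
  rcases le_total 0 x with h | h
  · have h1 := hM.dist_le_mul x hx' 1 (by norm_num)
    rw [Real.dist_eq, Real.dist_eq, ha.right, sub_zero, abs_sub_comm x 1,
      abs_of_nonneg (sub_nonneg.2 hx'.2)] at h1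
    rw [abs_of_nonneg h]
    exact (le_abs_self _).trans h1
  · have h1 := hM.dist_le_mul x hx' (-1) (by norm_num)
    rw [Real.dist_eq, Real.dist_eq, ha.left, sub_zero,
      abs_of_nonneg (show 0 ≤ x - -1 by linarith [hx'.1])] at h1
    rw [abs_of_nonpos h, sub_neg_eq_add]
    refine (le_abs_self _).trans (h1.trans (le_of_eq ?_))
    ring

theorem sqrt_pos {x : ℝ} (hx : x ∈ Ioo (-1 : ℝ) 1) : 0 < √(a x) := Real.sqrt_pos.2 (ha.pos x hx)

theorem continuousOn_inv_sqrt : ContinuousOn (fun x => (√(a x))⁻¹) (Ioo (-1) 1) :=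
  ((Real.continuous_sqrt.comp_continuousOn ha.continuousOn).mono Ioo_subset_Icc_self).inv₀
    fun _ hx => (ha.sqrt_pos hx).ne'

/-- The kernel representing the functional `g ↦ ∫₀ˣ g / √a` on `L²(-1,1)`. -/
theorem memLp_kernel {x : ℝ} (hx : x ∈ Ioo (-1 : ℝ) 1) :
    MemLp ((uIoc 0 x).indicator fun t => (√(a t))⁻¹) 2 μI := by
  have hsub : uIcc 0 x ⊆ Ioo (-1 : ℝ) 1 := (convex_Ioo (-1 : ℝ) 1).ordConnected.uIcc_subset
    (by norm_num) hx
  have hc := ha.continuousOn_inv_sqrt.mono hsub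
  obtain ⟨M, hM⟩ := isCompact_uIcc.exists_bound_of_continuousOn hc
  refine MemLp.of_bound (C := |M|) ?_ (Eventually.of_forall fun t => ?_)
  · rw [aestronglyMeasurable_indicator_iff measurableSet_uIoc]
    refine ((hc.mono uIoc_subset_uIcc).aestronglyMeasurable (μ := volume)
      measurableSet_uIoc).mono_measure ?_
    exact Measure.restrict_mono le_rfl Measure.restrict_le_self
  · by_cases ht : t ∈ uIoc 0 x
    · rw [indicator_of_mem ht]
      exact (hM t (uIoc_subset_uIcc ht)).trans (le_abs_self M)
    · rw [indicator_of_notMem ht, norm_zero]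
      exact abs_nonneg M

theorem intervalIntegrable_div (g : L2) {c d : ℝ} (hc : c ∈ Ioo (-1 : ℝ) 1)
    (hd : d ∈ Ioo (-1 : ℝ) 1) : IntervalIntegrable (fun t => (√(a t))⁻¹ * g t) volume c d := by
  refine IntervalIntegrable.continuousOn_mul ?_ (ha.continuousOn_inv_sqrt.mono
    ((convex_Ioo (-1 : ℝ) 1).ordConnected.uIcc_subset hc hd))
  exact intervalIntegrable_of_integrable' (MemLp.integrable_μI (Lp.memLp g))
    (Ioo_subset_Icc_self hc) (Ioo_subset_Icc_self hd)

theorem integral_div_eq_inner (g : L2) {x : ℝ} (hx : x ∈ Ioo (-1 : ℝ) 1) :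
    ∫ t in (0 : ℝ)..x, (√(a t))⁻¹ * g t =
      (if 0 ≤ x then 1 else -1 : ℝ) * ⟪(ha.memLp_kernel hx).toLp, g⟫ := by
  have hsub : uIoc 0 x ⊆ Ioo (-1 : ℝ) 1 := uIoc_subset_uIcc.trans
    ((convex_Ioo (-1 : ℝ) 1).ordConnected.uIcc_subset (by norm_num) hx)
  rw [intervalIntegral.intervalIntegral_eq_integral_uIoc, inner_eq_integral, smul_eq_mul]
  congr 1
  symm
  rw [integral_congr_ae (g := (uIoc 0 x).indicator fun t => (√(a t))⁻¹ * g t),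
    integral_indicator measurableSet_uIoc, Measure.restrict_restrict measurableSet_uIoc,
    inter_eq_left.2 hsub]
  filter_upwards [(ha.memLp_kernel hx).coeFn_toLp] with t ht
  rw [ht]
  by_cases h : t ∈ uIoc 0 x
  · simp [h]
  · simp [h]

theorem tendsto_integral_div {g : ℕ → L2} {g₀ : L2} (h : Tendsto g atTop (𝓝 g₀)) {x : ℝ}
    (hx : x ∈ Ioo (-1 : ℝ) 1) :
    Tendsto (fun n => ∫ t in (0 : ℝ)..x, (√(a t))⁻¹ * g n t) atTop
      (𝓝 (∫ t in (0 : ℝ)..x, (√(a t))⁻¹ * g₀ t)) := by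
  simp only [ha.integral_div_eq_inner _ hx]
  exact (tendsto_const_nhds.inner h).const_mul _

/-- `H¹ₐ(-1,1)` in terms of primitives. -/
theorem hasWeightedDeriv_iff (u g : L2) : HasWeightedDeriv a u g ↔
    ∃ κ : ℝ, (u : ℝ → ℝ) =ᵐ[μI] fun x => κ + ∫ t in (0 : ℝ)..x, (√(a t))⁻¹ * g t := by
  have h0 : (0 : ℝ) ∈ Ioo (-1 : ℝ) 1 := by norm_num
  constructor
  · rintro ⟨U, hU, hac, hg⟩
    refine ⟨U 0, ?_⟩
    filter_upwards [hU, ae_restrict_mem measurableSet_Ioo] with x hx hxI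
    have h1 := hac.integral_deriv h0 hxI
    have h2 : ∫ t in (0 : ℝ)..x, (√(a t))⁻¹ * g t = ∫ t in (0 : ℝ)..x, deriv U t := by
      refine intervalIntegral.integral_congr_ae
        (ae_uIoc_of_ae ?_ (by norm_num) (Ioo_subset_Icc_self hxI))
      filter_upwards [hg, ae_restrict_mem measurableSet_Ioo] with t ht htI
      rw [ht, inv_mul_cancel_left₀ (ha.sqrt_pos htI).ne']
    rw [hx, h2, h1]
    ring
  · rintro ⟨κ, hκ⟩
    have hprim : LocallyAC fun x => κ + ∫ t in (0 : ℝ)..x, (√(a t))⁻¹ * g t := by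
      intro c d hc hcd hd
      have hc0 : min c 0 ∈ Ioo (-1 : ℝ) 1 :=
        ⟨lt_min hc (by norm_num), (min_le_right _ _).trans_lt (by norm_num)⟩
      have hd0 : max d 0 ∈ Ioo (-1 : ℝ) 1 :=
        ⟨lt_of_lt_of_le (by norm_num) (le_max_right _ _), max_lt hd (by norm_num)⟩
      have h1 := (ha.intervalIntegrable_div g hc0 hd0
        ).absolutelyContinuousOnInterval_intervalIntegral (c := 0) (by
          rw [uIcc_of_le ((min_le_right _ _).trans (le_max_right _ _))]
          exact ⟨min_le_right _ _, le_max_right _ _⟩)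
      have h2 : AbsolutelyContinuousOnInterval (fun _ : ℝ => κ) (min c 0) (max d 0) :=
        (LipschitzWith.const κ).lipschitzOnWith.absolutelyContinuousOnInterval
      refine (h2.add h1).mono ?_
      rw [uIcc_of_le hcd, uIcc_of_le ((min_le_right _ _).trans (le_max_right _ _))]
      exact Icc_subset_Icc (min_le_left _ _) (le_max_left _ _)
    refine ⟨_, hκ, hprim, ?_⟩
    -- The integrand need not be integrable up to ±1, so (-1,1) is exhausted by compact intervals; n
    -- + 2 keeps the base point 0 inside each of them.
    have hder : ∀ n : ℕ, ∀ᵐ x, x ∈ uIcc (-1 + 1 / ((n : ℝ) + 2)) (1 - 1 / ((n : ℝ) + 2)) →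
        deriv (fun x => κ + ∫ t in (0 : ℝ)..x, (√(a t))⁻¹ * g t) x = (√(a x))⁻¹ * g x := by
      intro n
      have h1 : 1 / ((n : ℝ) + 2) ≤ 1 / 2 :=
        one_div_le_one_div_of_le (by norm_num) (by linarith [(Nat.cast_nonneg n : (0 : ℝ) ≤ n)])
      have h2 : 0 < 1 / ((n : ℝ) + 2) := by positivity
      have h3 := ha.intervalIntegrable_div g (c := -1 + 1 / ((n : ℝ) + 2))
        (d := 1 - 1 / ((n : ℝ) + 2)) ⟨by linarith, by linarith⟩ ⟨by linarith, by linarith⟩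
      filter_upwards [h3.ae_hasDerivAt_integral] with x hx hxI
      refine ((hx hxI 0 ?_).const_add κ).deriv
      rw [uIcc_of_le (by linarith)]
      exact ⟨by linarith, by linarith⟩
    rw [EventuallyEq, ae_restrict_iff' measurableSet_Ioo]
    filter_upwards [ae_all_iff.2 hder] with x hx hxI
    obtain ⟨n, hn⟩ := exists_nat_one_div_lt (show 0 < min (x + 1) (1 - x) from
      lt_min (by linarith [hxI.1]) (by linarith [hxI.2]))
    have hle : 1 / ((n : ℝ) + 2) ≤ 1 / ((n : ℝ) + 1) :=
      one_div_le_one_div_of_le (by positivity) (by linarith)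
    have h1 := hn.trans_le (min_le_left _ _)
    have h2 := hn.trans_le (min_le_right _ _)
    have hmem : x ∈ uIcc (-1 + 1 / ((n : ℝ) + 2)) (1 - 1 / ((n : ℝ) + 2)) := by
      rw [uIcc_of_le (by linarith)]
      exact ⟨by linarith, by linarith⟩
    rw [hx n hmem, mul_inv_cancel_left₀ (ha.sqrt_pos hxI).ne']

theorem isClosed_hasWeightedDeriv : IsClosed {p : L2 × L2 | HasWeightedDeriv a p.1 p.2} := by
  refine IsSeqClosed.isClosed fun p p₀ hp hlim => ?_
  simp only [mem_ofPred_eq, ha.hasWeightedDeriv_iff] at hp ⊢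
  choose κ hκ using hp
  have h1 : Tendsto (fun n => (p n).1) atTop (𝓝 p₀.1) := (continuous_fst.tendsto _).comp hlim
  have h2 : Tendsto (fun n => (p n).2) atTop (𝓝 p₀.2) := (continuous_snd.tendsto _).comp hlim
  obtain ⟨ns, hns, hae⟩ := (tendstoInMeasure_of_tendsto_Lp h1).exists_seq_tendsto_ae
  -- The constants κ do not depend on x, so convergence at almost every x forces the limiting
  -- expression to be a.e. constant.
  have hκlim : ∀ᵐ x ∂μI, Tendsto (fun i => κ (ns i)) atTop
      (𝓝 (p₀.1 x - ∫ t in (0 : ℝ)..x, (√(a t))⁻¹ * p₀.2 t)) := by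
    filter_upwards [hae, ae_all_iff.2 hκ, ae_restrict_mem measurableSet_Ioo] with x hx hx2 hxI
    have h3 := hx.sub ((ha.tendsto_integral_div h2 hxI).comp hns.tendsto_atTop)
    refine h3.congr fun i => ?_
    rw [hx2 (ns i)]
    simp
  have hne : NeBot (ae μI) := by
    rw [ae_neBot, Ne, Measure.restrict_eq_zero, Real.volume_Ioo]
    norm_num
  obtain ⟨x₀, hx₀⟩ := hκlim.exists
  refine ⟨p₀.1 x₀ - ∫ t in (0 : ℝ)..x₀, (√(a t))⁻¹ * p₀.2 t, ?_⟩
  filter_upwards [hκlim] with x hx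
  rw [tendsto_nhds_unique hx₀ hx]
  ring

end IsDegenerateWeight

theorem HasWeightedDeriv.add {a : ℝ → ℝ} {u g u' g' : L2} (h : HasWeightedDeriv a u g)
    (h' : HasWeightedDeriv a u' g') : HasWeightedDeriv a (u + u') (g + g') := by
  obtain ⟨U, h1, h2, h3⟩ := h
  obtain ⟨U', h1', h2', h3'⟩ := h'
  refine ⟨U + U', (Lp.coeFn_add u u').trans (h1.add h1'),
    fun c d hc hcd hd => (h2 c d hc hcd hd).add (h2' c d hc hcd hd), ?_⟩
  filter_upwards [h2.differentiable, h2'.differentiable, h3, h3', Lp.coeFn_add g g']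
    with x hx hx' k k' l
  rw [l, Pi.add_apply, k, k', deriv_add hx hx', mul_add]

theorem HasWeightedDeriv.smul {a : ℝ → ℝ} {u g : L2} (c : ℝ) (h : HasWeightedDeriv a u g) :
    HasWeightedDeriv a (c • u) (c • g) := by
  obtain ⟨U, h1, h2, h3⟩ := h
  refine ⟨fun x => c * U x, ?_, fun r s hr hrs hs => (h2 r s hr hrs hs).const_mul c, ?_⟩
  · filter_upwards [Lp.coeFn_smul c u, h1] with x k l
    simp [k, l]
  · filter_upwards [Lp.coeFn_smul c g, h3] with x k l
    simp only [deriv_const_mul_field, k, l, Pi.smul_apply, smul_eq_mul]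
    ring

theorem HasWeightedDeriv.zero (a : ℝ → ℝ) : HasWeightedDeriv a 0 0 := by
  refine ⟨fun _ => 0, Lp.coeFn_zero _ _ _, fun c d _ _ _ =>
    (LipschitzWith.const (0 : ℝ)).lipschitzOnWith.absolutelyContinuousOnInterval, ?_⟩
  filter_upwards [Lp.coeFn_zero ℝ 2 μI] with x hx
  exact hx.trans (by simp)

/-- Multiplication by a bounded function, as a bounded operator on `L²(-1,1)`. -/
def mulL (m : LInf) : L2 →L[ℝ] L2 := (ContinuousLinearMap.mul ℝ ℝ).holderL μI ∞ 2 2 m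

theorem coeFn_mulL (m : LInf) (u : L2) : (mulL m u : ℝ → ℝ) =ᵐ[μI] fun x => m x * u x :=
  ContinuousLinearMap.coeFn_holder (r := 2) (ContinuousLinearMap.mul ℝ ℝ) m u

/-- The graph of `u ↦ √a uₓ - m u`. -/
def twistedGraph (a : ℝ → ℝ) (m : LInf) : Submodule ℝ (L2 × L2) where
  carrier := {p | HasWeightedDeriv a p.1 (p.2 + mulL m p.1)}
  add_mem' {p p'} h h' := by
    have := HasWeightedDeriv.add h h'
    rw [mem_ofPred_eq, Prod.fst_add, Prod.snd_add, map_add]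
    convert this using 1
    abel
  zero_mem' := by
    simpa using HasWeightedDeriv.zero a
  smul_mem' c p h := by
    have := HasWeightedDeriv.smul c h
    rw [mem_ofPred_eq, Prod.smul_fst, Prod.smul_snd, map_smul]
    convert this using 1
    rw [smul_add]

theorem mem_twistedGraph {a : ℝ → ℝ} {m : LInf} {p : L2 × L2} :
    p ∈ twistedGraph a m ↔ HasWeightedDeriv a p.1 (p.2 + mulL m p.1) := Iff.rfl

theorem IsDegenerateWeight.isClosed_twistedGraph {a : ℝ → ℝ} (ha : IsDegenerateWeight a)
    (m : LInf) : IsClosed (twistedGraph a m : Set (L2 × L2)) :=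
  ha.isClosed_hasWeightedDeriv.preimage (f := fun p : L2 × L2 => (p.1, p.2 + mulL m p.1))
    (continuous_fst.prodMk (continuous_snd.add ((mulL m).continuous.comp continuous_fst)))

end WeightedDeriv

/-! ### Factorization of A₀ + α⋆ as -D*D and its kernel -/

section GroundState

/-- A degenerate weight `a` with a polynomial `p`, positive on `[-1, 1]`, that will be the ground
state of `A₀ + α` for a suitable potential `α`. -/
structure IsGroundState (a : ℝ → ℝ) (p : Polynomial ℝ) : Prop extends IsDegenerateWeight a where
  poly_pos : ∀ x ∈ Icc (-1 : ℝ) 1, 0 < p.eval x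

theorem contDiff_eval_poly (p : Polynomial ℝ) : ContDiff ℝ 1 fun x => p.eval x := by
  simpa using p.contDiff_aeval (𝕜 := ℝ) (R := ℝ) 1

/-- The logarithmic derivative `p' / p`. -/
def logDerivPoly (p : Polynomial ℝ) (x : ℝ) : ℝ := p.derivative.eval x / p.eval x

/-- The twist `√a p' / p`. -/
def twist (a : ℝ → ℝ) (p : Polynomial ℝ) (x : ℝ) : ℝ := √(a x) * logDerivPoly p x

/-- The potential `-(a p')' / p`, for which `p` is in the kernel of `A₀ + α`. -/
def potential (a : ℝ → ℝ) (p : Polynomial ℝ) (x : ℝ) : ℝ :=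
  -(deriv a x * p.derivative.eval x + a x * p.derivative.derivative.eval x) / p.eval x

namespace IsGroundState

variable {a : ℝ → ℝ} {p : Polynomial ℝ} (h : IsGroundState a p)
include h

theorem poly_ne {x : ℝ} (hx : x ∈ Icc (-1 : ℝ) 1) : p.eval x ≠ 0 := (h.poly_pos x hx).ne'

theorem contDiffOn_logDerivPoly : ContDiffOn ℝ 1 (logDerivPoly p) (Icc (-1) 1) :=
  (contDiff_eval_poly p.derivative).contDiffOn.div (contDiff_eval_poly p).contDiffOn fun _ hx => h.poly_ne hx

theorem continuousOn_twist : ContinuousOn (twist a p) (Icc (-1) 1) :=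
  (Real.continuous_sqrt.comp_continuousOn h.continuousOn).mul
    h.contDiffOn_logDerivPoly.continuousOn

theorem memLp_twist : MemLp (twist a p) ∞ μI := memLp_of_continuousOn h.continuousOn_twist _

theorem memLp_potential : MemLp (potential a p) ∞ μI := by
  obtain ⟨M, hM0, hM⟩ := h.exists_deriv_bound
  have h1 : MemLp (deriv a) ∞ μI :=
    memLp_top_of_bound (measurable_deriv a).aestronglyMeasurable hM ∞
  have h2 : MemLp (logDerivPoly p) ∞ μI :=
    memLp_of_continuousOn h.contDiffOn_logDerivPoly.continuousOn _
  have h3 : MemLp (fun x => a x * (p.derivative.derivative.eval x / p.eval x)) ∞ μI :=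
    memLp_of_continuousOn (h.continuousOn.mul
      ((Polynomial.continuous _).continuousOn.div p.continuous.continuousOn
        fun x hx => h.poly_ne hx)) _
  refine ((h1.mul h2 (r := ∞)).add h3).neg.ae_eq (Eventually.of_forall fun x => ?_)
  simp only [potential, logDerivPoly, Pi.neg_apply, Pi.add_apply, Pi.mul_apply]
  ring

/-- The twist as an element of `L^∞`. -/
def twistLInf : LInf := h.memLp_twist.toLp

/-- The potential as an element of `L^∞`. -/
def potentialLInf : LInf := h.memLp_potential.toLp

theorem coeFn_mulL_twist (u : L2) :
    (mulL h.twistLInf u : ℝ → ℝ) =ᵐ[μI] fun x => twist a p x * u x := by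
  filter_upwards [coeFn_mulL h.twistLInf u, h.memLp_twist.coeFn_toLp] with x h1 h2
  rw [h1, twistLInf, h2]

theorem coeFn_mulL_potential (u : L2) :
    (mulL h.potentialLInf u : ℝ → ℝ) =ᵐ[μI] fun x => potential a p x * u x := by
  filter_upwards [coeFn_mulL h.potentialLInf u, h.memLp_potential.coeFn_toLp] with x h1 h2
  rw [h1, potentialLInf, h2]

theorem sqrt_mul_twist {x : ℝ} (hx : x ∈ Icc (-1 : ℝ) 1) :
    √(a x) * twist a p x = a x * logDerivPoly p x := by
  rw [twist, ← mul_assoc, Real.mul_self_sqrt (h.nonneg hx)]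

/-- Riccati equation for a p'/p. It encodes that p solves (a p')' + α⋆ p = 0 and is the algebra
behind the factorization. -/
theorem hasDerivAt_flux {x : ℝ} (hx : x ∈ Ioo (-1 : ℝ) 1) :
    HasDerivAt (fun x => a x * logDerivPoly p x) (-potential a p x - twist a p x ^ 2) x := by
  have h0 := h.poly_ne (Ioo_subset_Icc_self hx)
  have h1 := (h.differentiableAt hx).hasDerivAt.fun_mul
    ((p.derivative.hasDerivAt x).fun_div (p.hasDerivAt x) h0)
  refine h1.congr_deriv ?_
  rw [twist, mul_pow, Real.sq_sqrt (h.nonneg (Ioo_subset_Icc_self hx)), potential, logDerivPoly]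
  field_simp
  ring

theorem ac_flux : AbsolutelyContinuousOnInterval (fun x => a x * logDerivPoly p x) (-1) 1 := by
  refine h.ac.fun_mul (ContDiffOn.absolutelyContinuousOnInterval ?_)
  rw [uIcc_of_le (by norm_num)]
  exact h.contDiffOn_logDerivPoly

theorem exists_flux_le :
    ∃ M, 0 ≤ M ∧ ∀ x ∈ Ioo (-1 : ℝ) 1, |a x * logDerivPoly p x| ≤ M * (1 - |x|) := by
  obtain ⟨M, hM, h1⟩ := h.exists_le_dist
  obtain ⟨N, hN, h2⟩ := exists_bound_Ioo h.contDiffOn_logDerivPoly.continuousOn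
  refine ⟨M * N, mul_nonneg hM hN, fun x hx => ?_⟩
  rw [abs_mul, abs_of_nonneg (h.nonneg (Ioo_subset_Icc_self hx))]
  calc a x * |logDerivPoly p x| ≤ M * (1 - |x|) * N :=
        mul_le_mul (h1 x hx) (h2 x hx) (abs_nonneg _)
          ((h.nonneg (Ioo_subset_Icc_self hx)).trans (h1 x hx))
    _ = _ := by ring

/-- Integration by parts: `⟨D u, D w⟩ = -⟨(a uₓ)ₓ + α u, w⟩` with `D u = √a uₓ - √a (p'/p) u`. -/
theorem exists_mem_twistedGraph {u f : L2} (hu : HasDivForm a u f) :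
    ∃ g, (u, g) ∈ twistedGraph a h.twistLInf ∧ ∀ r ∈ twistedGraph a h.twistLInf,
      ⟪g, r.2⟫ = -⟪f + mulL h.potentialLInf u, r.1⟫ := by
  obtain ⟨U, W, hU, hUac, hmem, hW, hWac, hW0, hW1, hf⟩ := hu
  refine ⟨hmem.toLp - mulL h.twistLInf u, ?_, ?_⟩
  · rw [mem_twistedGraph]
    refine ⟨U, hU, hUac, ?_⟩
    simpa using hmem.coeFn_toLp
  rintro ⟨w, k⟩ hr
  rw [mem_twistedGraph] at hr
  obtain ⟨V, hV, hVac, hk⟩ := hr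
  simp only at hV hk ⊢
  set g := hmem.toLp - mulL h.twistLInf u with hg
  -- F is √a (D u) w; by the Riccati equation its derivative is (D u)(D w) + ((a uₓ)ₓ + α⋆ u) w, so
  -- the claim is that F contributes no boundary term.
  set F : ℝ → ℝ := fun x => (W x - a x * logDerivPoly p x * U x) * V x with hF
  have hFac : LocallyAC F :=
    ((LocallyAC.of_ac hWac).sub ((LocallyAC.of_ac h.ac_flux).mul hUac)).mul hVac
  have hderiv : deriv F =ᵐ[μI] fun x =>
      g x * k x + (f + mulL h.potentialLInf u : L2) x * w x := by
    filter_upwards [hU, hV, hW, hf, hk, Lp.coeFn_add f (mulL h.potentialLInf u),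
      Lp.coeFn_sub hmem.toLp (mulL h.twistLInf u), Lp.coeFn_add k (mulL h.twistLInf w),
      hmem.coeFn_toLp, h.coeFn_mulL_twist u, h.coeFn_mulL_twist w, h.coeFn_mulL_potential u,
      ac_differentiable hWac, hUac.differentiable, hVac.differentiable,
      ae_restrict_mem measurableSet_Ioo] with x e1 e2 e3 e4 e5 e6 e7 e8 e9 e10 e11 e12 d1 d2 d3 hx
    have hd := (d1.hasDerivAt.fun_sub ((h.hasDerivAt_flux hx).fun_mul d2.hasDerivAt)).fun_mul d3.hasDerivAt
    have hd' : deriv F x = _ := hd.deriv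
    rw [hd']
    have hsq : √(a x) * √(a x) = a x :=
      Real.mul_self_sqrt (h.nonneg (Ioo_subset_Icc_self hx))
    have e13 := h.sqrt_mul_twist (Ioo_subset_Icc_self hx)
    rw [e8, Pi.add_apply, e11] at e5
    have e14 : k x = √(a x) * deriv V x - twist a p x * w x := by linarith
    rw [hg, e7, Pi.sub_apply, e9, e10, e6, Pi.add_apply, e12, e14, e4, e3, e1, e2, ← e13]
    linear_combination (-(deriv U x * deriv V x)) * hsq
  have hint : Integrable (deriv F) μI :=
    ((integrable_mul_L2 (Lp.memLp g) (Lp.memLp k)).add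
      (integrable_mul_L2 (Lp.memLp (f + mulL h.potentialLInf u)) (Lp.memLp w))).congr hderiv.symm
  obtain ⟨M, hM, hflux⟩ := h.exists_flux_le
  -- Young's inequality with parameter η, combined with W² ≤ (1 - |x|)‖f‖², bounds |W V|; the other
  -- term is O(1 - |x|) times an integrable function.
  have hzero := hFac.integral_deriv_eq_zero hint fun η hη => by
    refine ⟨fun x => ‖f‖ ^ 2 / (4 * η) * (w x * w x) + M * |u x * w x|,
      ((integrable_mul_L2 (Lp.memLp w) (Lp.memLp w)).const_mul _).add
        ((integrable_mul_L2 (Lp.memLp u) (Lp.memLp w)).abs.const_mul _), ?_⟩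
    filter_upwards [hU, hV, ae_restrict_mem measurableSet_Ioo] with x e1 e2 hx
    have h1 := AbsolutelyContinuousOnInterval.sq_le hWac hW0 hW1 hf hx
    have h2 : |W x * V x| ≤ η + (1 - |x|) * (‖f‖ ^ 2 / (4 * η) * (V x * V x)) := by
      have h3 : |W x * V x| ≤ η + (W x * V x) ^ 2 / (4 * η) := by
        rw [← sub_nonneg, ← sq_abs (W x * V x)]
        have : η + |W x * V x| ^ 2 / (4 * η) - |W x * V x| =
            (|W x * V x| - 2 * η) ^ 2 / (4 * η) := by field_simp; ring
        rw [this]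
        positivity
      refine h3.trans (add_le_add_right ?_ η)
      rw [mul_pow]
      calc W x ^ 2 * V x ^ 2 / (4 * η) ≤ ((1 - |x|) * ‖f‖ ^ 2) * V x ^ 2 / (4 * η) := by gcongr
        _ = _ := by ring
    have h4 : |a x * logDerivPoly p x * U x * V x| ≤ (1 - |x|) * (M * |U x * V x|) := by
      rw [mul_assoc _ (U x), abs_mul]
      calc _ ≤ M * (1 - |x|) * |U x * V x| := by gcongr; exact hflux x hx
        _ = _ := by ring
    rw [e1, e2, hF]
    simp only [sub_mul]
    refine (abs_sub _ _).trans ?_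
    linarith
  rw [integral_congr_ae hderiv, integral_add (integrable_mul_L2 (Lp.memLp g) (Lp.memLp k))
    (integrable_mul_L2 (Lp.memLp (f + mulL h.potentialLInf u)) (Lp.memLp w)),
    ← inner_eq_integral, ← inner_eq_integral] at hzero
  linarith

/-- Conversely, `-D*D` is a restriction of `A₀ + α`. -/
theorem hasDivForm_of_weak {u f g : L2} (hug : (u, g) ∈ twistedGraph a h.twistLInf)
    (hw : ∀ r ∈ twistedGraph a h.twistLInf, ⟪g, r.2⟫ = -⟪f, r.1⟫) :
    HasDivForm a u (f - mulL h.potentialLInf u) := by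
  rw [mem_twistedGraph] at hug
  obtain ⟨U, hU, hUac, hgU⟩ := hug
  simp only at hU hgU
  set r : L2 := mulL h.twistLInf g - f with hr
  -- testing against absolutely continuous functions on `[-1, 1]`
  have htest : ∀ V : ℝ → ℝ, AbsolutelyContinuousOnInterval V (-1) 1 → ∀ k : L2,
      deriv V =ᵐ[μI] k → ∫ x, √(a x) * g x * k x ∂μI = ∫ x, r x * V x ∂μI := by
    intro V hV k hk
    have hVm : MemLp V 2 μI := memLp_of_continuousOn (by
      have := hV.continuousOn
      rwa [uIcc_of_le (by norm_num)] at this) 2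
    have hsm : MemLp (fun x => √(a x)) ∞ μI := memLp_of_continuousOn
      (Real.continuous_sqrt.comp_continuousOn h.continuousOn) _
    have hskm : MemLp (fun x => √(a x) * k x) 2 μI := (Lp.memLp k).mul hsm
    have hsgm : MemLp (fun x => √(a x) * g x) 2 μI := (Lp.memLp g).mul hsm
    have hmem : (hVm.toLp, hskm.toLp - mulL h.twistLInf hVm.toLp) ∈
        twistedGraph a h.twistLInf := by
      rw [mem_twistedGraph]
      refine ⟨V, hVm.coeFn_toLp, LocallyAC.of_ac hV, ?_⟩
      simp only [sub_add_cancel]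
      filter_upwards [hskm.coeFn_toLp, hk] with x e1 e2
      rw [e1, e2]
    have h1 := hw _ hmem
    simp only [inner_sub_right] at h1
    have h2 : ⟪g, hskm.toLp⟫ = ∫ x, √(a x) * g x * k x ∂μI := by
      rw [inner_eq_integral]
      refine integral_congr_ae ?_
      filter_upwards [hskm.coeFn_toLp] with x e1
      rw [e1]; ring
    have h3 : ⟪g, mulL h.twistLInf hVm.toLp⟫ - ⟪f, hVm.toLp⟫ = ∫ x, r x * V x ∂μI := by
      have : ⟪g, mulL h.twistLInf hVm.toLp⟫ = ⟪mulL h.twistLInf g, hVm.toLp⟫ := by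
        rw [inner_eq_integral, inner_eq_integral]
        refine integral_congr_ae ?_
        filter_upwards [h.coeFn_mulL_twist g, h.coeFn_mulL_twist hVm.toLp] with x e1 e2
        rw [e1, e2]; ring
      rw [this, ← inner_sub_left, ← hr, inner_eq_integral]
      refine integral_congr_ae ?_
      filter_upwards [hVm.coeFn_toLp] with x e1
      rw [e1]
    rw [← h2, ← h3]
    linarith
  have hri : Integrable r μI := MemLp.integrable_μI (Lp.memLp r)
  set P : ℝ → ℝ := fun x => ∫ t in (-1 : ℝ)..x, r t with hPdef
  have hPac : AbsolutelyContinuousOnInterval P (-1) 1 := ac_integral hri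
  have hPd : deriv P =ᵐ[μI] r := deriv_integral_ae hri
  have hP0 : P (-1) = 0 := by simp [hPdef]
  -- Testing against the constant 1 produces the Neumann condition at the right endpoint.
  have hP1 : P 1 = 0 := by
    have h1 := htest (fun _ => 1)
      (LipschitzWith.const (1 : ℝ)).lipschitzOnWith.absolutelyContinuousOnInterval 0 (by
        filter_upwards [Lp.coeFn_zero ℝ 2 μI] with x e1
        rw [e1]; simp)
    have h2 : ∫ x, √(a x) * g x * (0 : L2) x ∂μI = 0 := by
      rw [integral_congr_ae (g := fun _ => (0 : ℝ)), integral_zero]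
      filter_upwards [Lp.coeFn_zero ℝ 2 μI] with x e1
      rw [e1]; simp
    rw [h2, integral_μI] at h1
    simpa [hPdef] using h1.symm
  have hPc : ContinuousOn P (Icc (-1) 1) := by
    have := hPac.continuousOn
    rwa [uIcc_of_le (by norm_num)] at this
  -- identification of the flux
  have hflux : (fun x => √(a x) * g x) =ᵐ[μI] fun x => -P x := by
    have hm : MemLp (fun x => √(a x) * g x + P x) 2 μI :=
      ((Lp.memLp g).mul (memLp_of_continuousOn (p := ∞)
        (Real.continuous_sqrt.comp_continuousOn h.continuousOn))).add (memLp_of_continuousOn hPc 2)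
    -- Testing against a primitive of √a g + P itself gives ‖√a g + P‖² = 0.
    set k : L2 := hm.toLp with hk
    have hki : Integrable k μI := MemLp.integrable_μI (Lp.memLp k)
    set V : ℝ → ℝ := fun x => ∫ t in (-1 : ℝ)..x, k t with hV
    have hVac : AbsolutelyContinuousOnInterval V (-1) 1 := ac_integral hki
    have hVd : deriv V =ᵐ[μI] k := deriv_integral_ae hki
    have h1 := htest V hVac k hVd
    have h2 : ∫ x, r x * V x ∂μI = -∫ x, P x * k x ∂μI := by
      have h3 := hPac.integral_mul_deriv_eq_deriv_mul hVac
      rw [hP0, hP1, zero_mul, zero_mul, sub_zero, zero_sub, ← integral_μI, ← integral_μI] at h3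
      have h5 : ∫ x, P x * k x ∂μI = ∫ x, P x * deriv V x ∂μI :=
        integral_congr_ae (by filter_upwards [hVd] with x e1; rw [e1])
      rw [h5, h3, neg_neg]
      refine integral_congr_ae ?_
      filter_upwards [hPd] with x e1
      rw [e1]
    have hi1 : Integrable (fun x => √(a x) * g x * k x) μI :=
      integrable_mul_L2 ((Lp.memLp g).mul (memLp_of_continuousOn (p := ∞)
        (Real.continuous_sqrt.comp_continuousOn h.continuousOn))) (Lp.memLp k)
    have hi2 : Integrable (fun x => P x * k x) μI :=
      integrable_mul_L2 (memLp_of_continuousOn hPc 2) (Lp.memLp k)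
    have h4 : ⟪k, k⟫ = 0 := by
      rw [inner_eq_integral, integral_congr_ae
        (g := fun x => √(a x) * g x * k x + P x * k x), integral_add hi1 hi2, h1, h2,
        neg_add_cancel]
      filter_upwards [hm.coeFn_toLp] with x e1
      nth_rw 1 [hk]
      rw [e1]
      ring
    have h5 : k = 0 := inner_self_eq_zero.1 h4
    filter_upwards [hm.coeFn_toLp, Lp.coeFn_zero ℝ 2 μI] with x e1 e2
    rw [← hk, h5, e2] at e1
    simp only [Pi.zero_apply] at e1
    linarith
  have hBac : LocallyAC fun x => a x * logDerivPoly p x * U x :=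
    (LocallyAC.of_ac h.ac_flux).mul hUac
  have hBd : deriv (fun x => a x * logDerivPoly p x * U x) =ᵐ[μI]
      fun x => -(mulL h.potentialLInf u : L2) x + (mulL h.twistLInf g : L2) x := by
    filter_upwards [hU, hgU, h.coeFn_mulL_potential u, h.coeFn_mulL_twist g,
      h.coeFn_mulL_twist u, Lp.coeFn_add g (mulL h.twistLInf u), hUac.differentiable,
      ae_restrict_mem measurableSet_Ioo] with x e1 e2 e3 e4 e5 e6 d1 hx
    rw [((h.hasDerivAt_flux hx).fun_mul d1.hasDerivAt).deriv, e3, e4]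
    rw [e6, Pi.add_apply, e5] at e2
    have e7 : g x = √(a x) * deriv U x - twist a p x * u x := by linarith
    rw [e7, e1, ← h.sqrt_mul_twist (Ioo_subset_Icc_self hx)]
    ring
  obtain ⟨M, hM, hfl⟩ := h.exists_flux_le
  obtain ⟨B, hBeq, hB, hB0, hB1⟩ := hBac.exists_extension
    (((MemLp.integrable_μI (Lp.memLp (mulL h.potentialLInf u))).neg.add
      (MemLp.integrable_μI (Lp.memLp (mulL h.twistLInf g)))).congr hBd.symm) fun η hη => by
    refine ⟨fun x => M * |u x|, (MemLp.integrable_μI (Lp.memLp u)).abs.const_mul M, ?_⟩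
    filter_upwards [hU, ae_restrict_mem measurableSet_Ioo] with x e1 hx
    rw [e1, abs_mul]
    have h1 := mul_le_mul_of_nonneg_right (hfl x hx) (abs_nonneg (U x))
    nlinarith
  have hBd' : deriv B =ᵐ[μI] deriv fun x => a x * logDerivPoly p x * U x := by
    filter_upwards [ae_restrict_mem measurableSet_Ioo] with x hx
    exact (Filter.eventuallyEq_of_mem (isOpen_Ioo.mem_nhds hx) hBeq).deriv_eq
  -- The flux splits as a U' = a(p'/p)U + √a g, where B extends the first term to [-1,1] and the
  -- second equals -P.
  refine ⟨U, B - P, hU, hUac, (Lp.memLp (g + mulL h.twistLInf u)).ae_eq hgU, ?_, hB.sub hPac,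
    by simp [hB0, hP0], by simp [hB1, hP1], ?_⟩
  · filter_upwards [hU, hgU, hflux, h.coeFn_mulL_twist u, Lp.coeFn_add g (mulL h.twistLInf u),
      ae_restrict_mem measurableSet_Ioo] with x e1 e2 e3 e4 e5 hx
    rw [e5, Pi.add_apply, e4] at e2
    have hsq : √(a x) * √(a x) = a x := Real.mul_self_sqrt (h.nonneg (Ioo_subset_Icc_self hx))
    have e6 : P x = -(√(a x) * g x) := by linarith
    have e7 : g x = √(a x) * deriv U x - twist a p x * u x := by linarith
    have e8 := h.sqrt_mul_twist (Ioo_subset_Icc_self hx)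
    rw [Pi.sub_apply, hBeq hx, e6, e7, e1]
    linear_combination (-U x) * e8 + deriv U x * hsq
  · filter_upwards [hBd, hBd', hPd, ac_differentiable hB, ac_differentiable hPac,
      Lp.coeFn_sub f (mulL h.potentialLInf u), Lp.coeFn_sub (mulL h.twistLInf g) f]
      with x e1 e2 e3 d1 d2 e4 e5
    rw [deriv_sub d1 d2, e2, e1, e3, e4, hr, e5]
    simp only [Pi.sub_apply]
    ring

/-- Since a vanishes at ±1, every polynomial satisfies the boundary condition. Hence the domain is
dense. -/
theorem polyL2_hasDivForm (s : Polynomial ℝ) : ∃ f, HasDivForm a (polyL2 s) f := by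
  obtain ⟨M, hM0, hM⟩ := h.exists_deriv_bound
  have hc : ∀ t : Polynomial ℝ, AbsolutelyContinuousOnInterval (fun x => t.eval x) (-1) 1 :=
    fun t => ContDiffOn.absolutelyContinuousOnInterval (contDiff_eval_poly t).contDiffOn
  have hW : AbsolutelyContinuousOnInterval (fun x => a x * s.derivative.eval x) (-1) 1 :=
    h.ac.fun_mul (hc _)
  have hWd : ∀ x ∈ Ioo (-1 : ℝ) 1, deriv (fun x => a x * s.derivative.eval x) x =
      deriv a x * s.derivative.eval x + a x * s.derivative.derivative.eval x := fun x hx =>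
    ((h.differentiableAt hx).hasDerivAt.mul (s.derivative.hasDerivAt x)).deriv
  obtain ⟨N, hN0, hN⟩ := exists_bound_Ioo (s.derivative.continuous.continuousOn)
  obtain ⟨N', hN0', hN'⟩ := exists_bound_Ioo
    (h.continuousOn.mul s.derivative.derivative.continuous.continuousOn)
  have hm : MemLp (deriv fun x => a x * s.derivative.eval x) 2 μI :=
    memLp_top_of_bound (measurable_deriv _).aestronglyMeasurable (M := M * N + N')
      (fun x hx => by
        rw [hWd x hx]
        refine (abs_add_le _ _).trans (add_le_add ?_ (hN' x hx))
        rw [abs_mul]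
        exact mul_le_mul (hM x hx) (hN x hx) (abs_nonneg _) hM0) 2
  refine ⟨hm.toLp, fun x => s.eval x, fun x => a x * s.derivative.eval x, coeFn_polyL2 s,
    LocallyAC.of_ac (hc s), ?_, ?_, hW, by simp [h.left], by simp [h.right], hm.coeFn_toLp⟩
  · refine memLp_of_continuousOn ?_ 2
    simp only [Polynomial.deriv]
    exact (Real.continuous_sqrt.comp_continuousOn h.continuousOn).mul
      s.derivative.continuous.continuousOn
  · simp only [Polynomial.deriv]
    rfl

theorem eq_zero_of_inner (z : L2) (hz : ∀ r ∈ twistedGraph a h.twistLInf, ⟪z, r.1⟫ = 0) :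
    z = 0 := by
  refine dense_polyL2.eq_zero_of_inner_left ℝ ?_
  rintro _ ⟨s, rfl⟩
  obtain ⟨f, hf⟩ := h.polyL2_hasDivForm s
  obtain ⟨g, hg, -⟩ := h.exists_mem_twistedGraph hf
  exact hz _ hg

theorem polyL2_mem : (polyL2 p, 0) ∈ twistedGraph a h.twistLInf := by
  rw [mem_twistedGraph]
  refine ⟨fun x => p.eval x, coeFn_polyL2 p, LocallyAC.of_ac
    (ContDiffOn.absolutelyContinuousOnInterval (contDiff_eval_poly p).contDiffOn), ?_⟩
  simp only [zero_add]
  filter_upwards [h.coeFn_mulL_twist (polyL2 p), coeFn_polyL2 p,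
    ae_restrict_mem measurableSet_Ioo] with x e1 e2 hx
  have := h.poly_ne (Ioo_subset_Icc_self hx)
  rw [e1, e2, twist, logDerivPoly, Polynomial.deriv]
  field_simp

/-- D u = √a p (u/p)', so D u = 0 forces u/p to be constant. -/
theorem eq_smul_of_mem {u : L2} (hu : (u, 0) ∈ twistedGraph a h.twistLInf) :
    ∃ c : ℝ, u = c • polyL2 p := by
  rw [mem_twistedGraph] at hu
  obtain ⟨U, hU, hUac, hgU⟩ := hu
  simp only [zero_add] at hU hgU
  have hinv : ContDiffOn ℝ 1 (fun x => (p.eval x)⁻¹) (Icc (-1) 1) :=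
    (contDiff_eval_poly p).contDiffOn.inv fun x hx => h.poly_ne hx
  have hFac : LocallyAC fun x => U x * (p.eval x)⁻¹ := hUac.mul (LocallyAC.of_ac (by
    refine ContDiffOn.absolutelyContinuousOnInterval ?_
    rw [uIcc_of_le (by norm_num)]
    exact hinv))
  have hFd : deriv (fun x => U x * (p.eval x)⁻¹) =ᵐ[μI] 0 := by
    filter_upwards [hU, hgU, h.coeFn_mulL_twist u, hUac.differentiable,
      ae_restrict_mem measurableSet_Ioo] with x e1 e2 e3 d1 hx
    have h0 := h.poly_ne (Ioo_subset_Icc_self hx)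
    rw [(d1.hasDerivAt.fun_mul ((p.hasDerivAt x).fun_inv h0)).deriv]
    rw [e3, e1, twist, mul_assoc] at e2
    have e4 := mul_left_cancel₀ (h.sqrt_pos hx).ne' e2
    rw [← e4, logDerivPoly, Pi.zero_apply]
    field_simp
    ring
  refine ⟨U 0 * (p.eval 0)⁻¹, Lp.ext ?_⟩
  filter_upwards [hU, coeFn_polyL2 p, Lp.coeFn_smul (U 0 * (p.eval 0)⁻¹) (polyL2 p),
    ae_restrict_mem measurableSet_Ioo] with x e1 e2 e3 hx
  have h0 := h.poly_ne (Ioo_subset_Icc_self hx)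
  rw [e1, e3, Pi.smul_apply, e2, ← hFac.eq_of_deriv_zero hFd hx, smul_eq_mul,
    inv_mul_cancel_right₀ h0]

end IsGroundState

end GroundState

/-! ### The controlled operator, its adjoint and the weak solution -/

section Operator

theorem hasDivForm_opA {a : ℝ → ℝ} {α : LInf} (u : (opA a α).domain) :
    HasDivForm a (u : L2) (opA a α u - mulL α u) := by
  have h : ((u : L2), A₀ a u) ∈ (A₀ a).graph := (A₀ a).mem_graph u
  have h2 : opA a α u = mulL α u + A₀ a u := rfl
  rw [h2, add_sub_cancel_left]
  exact (mem_graph_A₀ a _ _).1 h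

theorem exists_opA_eq {a : ℝ → ℝ} {α : LInf} {u f : L2} (h : HasDivForm a u f) :
    ∃ w : (opA a α).domain, (w : L2) = u ∧ opA a α w = f + mulL α u := by
  obtain ⟨w, hw, hf⟩ := (LinearPMap.mem_graph_iff _).1 ((mem_graph_A₀ a u f).2 h)
  refine ⟨w, hw, ?_⟩
  have h2 : opA a α w = mulL α w + A₀ a w := rfl
  rw [h2, hf, add_comm]
  simp only at hw
  rw [hw]

/-- The constant function `δ` as an element of `L^∞`. -/
def constLInf (δ : ℝ) : LInf := (memLp_const δ : MemLp (fun _ : ℝ => δ) ∞ μI).toLp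

theorem mulL_add_const (m : LInf) (δ : ℝ) (u : L2) :
    mulL (m + constLInf δ) u = mulL m u + δ • u := by
  refine Lp.ext ?_
  filter_upwards [coeFn_mulL (m + constLInf δ) u, coeFn_mulL m u, Lp.coeFn_add m (constLInf δ),
    (memLp_const δ : MemLp (fun _ : ℝ => δ) ∞ μI).coeFn_toLp, Lp.coeFn_add (mulL m u) (δ • u),
    Lp.coeFn_smul δ u] with x e1 e2 e3 e4 e5 e6
  rw [e1, e3, e5, Pi.add_apply, Pi.add_apply, e2, e6, constLInf, e4, Pi.smul_apply, smul_eq_mul]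
  ring

namespace IsGroundState

variable {a : ℝ → ℝ} {p : Polynomial ℝ} (h : IsGroundState a p)
  {J : L2 →L[ℝ] L2} {R : L2 →L[ℝ] L2} {S : ℝ → L2 →L[ℝ] L2}
include h

/-- The control: the potential with ground state `p`, shifted by a constant. -/
def control (δ : ℝ) : LInf := h.potentialLInf + constLInf δ

theorem mulL_control (δ : ℝ) (u : L2) :
    mulL (h.control δ) u = mulL h.potentialLInf u + δ • u := mulL_add_const _ _ _

theorem dense_domain (δ : ℝ) : Dense ((opA a (h.control δ)).domain : Set L2) := by
  refine dense_polyL2.mono ?_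
  rintro _ ⟨s, rfl⟩
  obtain ⟨f, hf⟩ := h.polyL2_hasDivForm s
  obtain ⟨w, hw, -⟩ := exists_opA_eq (α := h.control δ) hf
  exact hw ▸ w.2

/-- The inclusion of A₀ + α⋆ in -D*D, in resolvent form; `exists_domain` is the reverse inclusion.
-/
theorem apply_of_domain (hJ : IsGraphResolvent (twistedGraph a h.twistLInf) J R) {δ : ℝ}
    (u : (opA a (h.control δ)).domain) :
    (u : L2) = J (u - (opA a (h.control δ) u - δ • (u : L2))) := by
  have h1 := hasDivForm_opA u
  generalize opA a (h.control δ) u = f at h1 ⊢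
  rw [h.mulL_control] at h1
  obtain ⟨g, hg, hw⟩ := h.exists_mem_twistedGraph h1
  refine (hJ.eq_apply hg hw).trans (congrArg J ?_)
  abel

theorem exists_domain (hJ : IsGraphResolvent (twistedGraph a h.twistLInf) J R) (δ : ℝ) (z : L2) :
    ∃ w : (opA a (h.control δ)).domain, (w : L2) = J z ∧
      opA a (h.control δ) w = J z - z + δ • J z := by
  have h1 : HasDivForm a (J z) (J z - z - mulL h.potentialLInf (J z)) := by
    refine h.hasDivForm_of_weak (hJ.mem z) fun r hr => ?_
    rw [← hJ.inner_eq z r hr, ← inner_neg_left, neg_sub]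
  obtain ⟨w, hw, he⟩ := exists_opA_eq (α := h.control δ) h1
  refine ⟨w, hw, ?_⟩
  rw [he, h.mulL_control]
  abel

/-- With `exists_of_adjoint`, this describes the adjoint through the range of the symmetric operator
J, in effect self-adjointness. Uniqueness needs enough test functions; existence needs to know all
of them. -/
theorem mem_adjoint (hJ : IsGraphResolvent (twistedGraph a h.twistLInf) J R) (δ : ℝ) (ψ : L2) :
    ∃ φ : (opA a (h.control δ)).adjoint.domain, (φ : L2) = J ψ ∧
      (opA a (h.control δ)).adjoint φ = (1 + δ) • J ψ - ψ := by
  have hkey : ∀ u : (opA a (h.control δ)).domain,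
      ⟪(1 + δ) • J ψ - ψ, (u : L2)⟫ = ⟪J ψ, opA a (h.control δ) u⟫ := by
    intro u
    have h1 := h.apply_of_domain hJ u
    set f := opA a (h.control δ) u with hf
    have h2 : ⟪ψ, (u : L2)⟫ = ⟪J ψ, (u : L2) - (f - δ • (u : L2))⟫ := by
      rw [hJ.symm, ← h1]
    rw [inner_sub_left, h2, real_inner_smul_left, inner_sub_right, inner_sub_right,
      real_inner_smul_right]
    ring
  have hmem := LinearPMap.mem_adjoint_domain_of_exists (T := opA a (h.control δ)) (J ψ) ⟨_, hkey⟩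
  exact ⟨⟨J ψ, hmem⟩, rfl, LinearPMap.adjoint_apply_eq (h.dense_domain δ) ⟨J ψ, hmem⟩ hkey⟩

theorem exists_of_adjoint (hJ : IsGraphResolvent (twistedGraph a h.twistLInf) J R) (δ : ℝ)
    (φ : (opA a (h.control δ)).adjoint.domain) :
    ∃ ψ, (φ : L2) = J ψ ∧ (opA a (h.control δ)).adjoint φ = δ • J ψ - (ψ - J ψ) := by
  set f := (opA a (h.control δ)).adjoint φ with hf
  have hkey : (φ : L2) = J (φ - (f - δ • (φ : L2))) := by
    refine ext_inner_left ℝ fun z => ?_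
    obtain ⟨w, hw, he⟩ := h.exists_domain hJ δ z
    have h1 := LinearPMap.adjoint_isFormalAdjoint (h.dense_domain δ) φ w
    rw [← hf, hw, he, real_inner_comm, inner_add_right, inner_sub_right,
      real_inner_smul_right] at h1
    rw [← hJ.symm, inner_sub_right, inner_sub_right, real_inner_smul_right, real_inner_comm,
      real_inner_comm (φ : L2) (J z)]
    linarith
  refine ⟨_, hkey, ?_⟩
  rw [← hkey]
  abel

/-- The shift δ only contributes the scalar exp(δt). For the energy, √a vₓ is D v plus the bounded
twist times v. -/
theorem isWeakSolution (hJ : IsGraphResolvent (twistedGraph a h.twistLInf) J R)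
    (hS : IsSemigroupOf (1 - J) S) {T : ℝ} (hT : 0 ≤ T) (δ : ℝ) (v₀ : L2) :
    IsWeakSolution a (h.control δ) T v₀ fun t => Real.exp (δ * t) • S t v₀ where
  continuousOn := (by fun_prop : Continuous fun t : ℝ => Real.exp (δ * t)).continuousOn.smul
    ((hS.continuousOn v₀).mono Icc_subset_Ici_self)
  energy := by
    obtain ⟨g, hg, hmem⟩ := hS.exists_energy hJ (h.isClosed_twistedGraph _) h.eq_zero_of_inner
      hT v₀
    refine ⟨fun t => Real.exp (δ * t) • (g t + mulL h.twistLInf (S t v₀)), ?_, ?_⟩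
    · have hexp : MemLp (fun t : ℝ => Real.exp (δ * t)) ∞ (volume.restrict (Ioo 0 T)) := by
        have hc : Continuous fun t : ℝ => Real.exp (δ * t) := by fun_prop
        obtain ⟨M, hM⟩ := (isCompact_Icc (a := (0 : ℝ)) (b := T)).exists_bound_of_continuousOn
          hc.continuousOn
        exact MemLp.of_bound hc.aestronglyMeasurable M
          ((ae_restrict_iff' measurableSet_Ioo).2
            (Eventually.of_forall fun t ht => hM t (Ioo_subset_Icc_self ht)))
      exact (hg.add (hS.memLp_comp (mulL h.twistLInf) T v₀)).smul hexp
    · filter_upwards [hmem] with t ht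
      exact HasWeightedDeriv.smul _ ht
  initial := by simp [hS.zero]
  weak φ := by
    obtain ⟨ψ, h1, h2⟩ := h.exists_of_adjoint hJ δ φ
    have h3 := hS.weak_form v₀ ψ δ hT
    simp only [sub_apply, one_apply_eq_self, sub_sub_cancel] at h3
    rw [h2, h1]
    exact ⟨h3.1, (ae_restrict_iff' measurableSet_Ioo).2 (Eventually.of_forall h3.2)⟩

theorem eqOn_of_isWeakSolution (hJ : IsGraphResolvent (twistedGraph a h.twistLInf) J R)
    {T : ℝ} (hT : 0 ≤ T) {δ : ℝ} {v₀ : L2} {v w : ℝ → L2}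
    (hv : IsWeakSolution a (h.control δ) T v₀ v) (hw : IsWeakSolution a (h.control δ) T v₀ w) :
    EqOn w v (Icc 0 T) := by
  intro t ht
  refine sub_eq_zero.1 (eqOn_zero_of_weak (z := fun t => w t - v t) hJ.symm hJ.inner_nonneg
    (fun x hx => hJ.eq_zero h.eq_zero_of_inner hx) hT (hw.continuousOn.sub hv.continuousOn)
    (by rw [hw.initial, hv.initial, sub_self]) (1 + δ) (fun ψ => ?_) t ht)
  obtain ⟨φ, h1, h2⟩ := h.mem_adjoint hJ δ ψ
  have hv' := hv.weak φ
  have hw' := hw.weak φ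
  rw [h1, h2] at hv' hw'
  simp only [inner_sub_left]
  refine ⟨hw'.1.sub hv'.1, ?_⟩
  filter_upwards [hw'.2, hv'.2] with s e1 e2
  exact e1.fun_sub e2

/-- The semigroup converges to the projection on the ground state. -/
theorem tendsto_semigroup (hJ : IsGraphResolvent (twistedGraph a h.twistLInf) J R)
    (hS : IsSemigroupOf (1 - J) S) (v₀ : L2) :
    ∃ β : ℝ, Tendsto (fun t => S t v₀) atTop (𝓝 (β • polyL2 p)) ∧
      β * ‖polyL2 p‖ ^ 2 = ⟪v₀, polyL2 p⟫ := by
  obtain ⟨y, hy, hCy, hin⟩ := hS.exists_tendsto v₀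
  -- A vector fixed by J has Rz = 0, that is D y = 0, so the limit is a multiple of p.
  have hyJ : y = J y := by
    rw [sub_apply, one_apply_eq_self, sub_eq_zero] at hCy
    exact hCy
  have hR : R y = 0 := by
    have h1 := hJ.norm_sq_eq y
    rw [← hyJ, sub_self, inner_zero_left] at h1
    exact norm_eq_zero.1 (pow_eq_zero_iff two_ne_zero |>.1 h1)
  have hmem := hJ.mem y
  rw [← hyJ, hR] at hmem
  obtain ⟨β, rfl⟩ := h.eq_smul_of_mem hmem
  have hφ : (1 - J) (polyL2 p) = 0 := by
    have h1 := hJ.eq_apply (f := 0) h.polyL2_mem fun r _ => by simp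
    rw [sub_zero] at h1
    rw [sub_apply, one_apply_eq_self, ← h1, sub_self]
  refine ⟨β, hy, ?_⟩
  rw [← hin _ hφ, real_inner_smul_left, real_inner_self_eq_norm_sq]

end IsGroundState

end Operator

end DegenerateParabolic

end

/-! ### Choice of the control and of the time -/

theorem theorem1p4 (a : ℝ → ℝ)
    (ha_smooth : ContDiffOn ℝ 1 a (Set.Icc (-1) 1))
    (ha_pos : ∀ x ∈ Set.Ioo (-1 : ℝ) 1, 0 < a x)
    (ha_left : a (-1) = 0) (ha_right : a 1 = 0)
    (hA : MeasureTheory.IntegrableOn (fun x => ∫ s in (0 : ℝ)..x, 1 / a s) (Set.Ioo (-1) 1))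
    (vd v₀ : DegenerateParabolic.L2) (hvd : 0 ≤ vd)
    (hpos : 0 < ∫ x in Set.Ioo (-1 : ℝ) 1, v₀ x * vd x)
    (ε : ℝ) (hε : 0 < ε) :
    ∃ T : ℝ, 0 ≤ T ∧ ∃ (α : DegenerateParabolic.LInf) (v : ℝ → DegenerateParabolic.L2),
      DegenerateParabolic.IsWeakSolution a α T v₀ v ∧
      (∀ w : ℝ → DegenerateParabolic.L2,
        DegenerateParabolic.IsWeakSolution a α T v₀ w → Set.EqOn w v (Set.Icc 0 T)) ∧
      ‖v T - vd‖ ≤ ε := by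
  rw [← DegenerateParabolic.inner_eq_integral] at hpos
  set m := inner ℝ v₀ vd with hm
  -- The first bound spends half of ε; the second keeps ⟨v₀, p⟩ positive.
  obtain ⟨p, hp, hpd⟩ := DegenerateParabolic.exists_pos_polyL2_near hvd
    (ε := min (ε / 2) (m / (‖v₀‖ + 1))) (lt_min (by positivity) (by positivity))
  set φ := DegenerateParabolic.polyL2 p with hφ
  have hpos' : 0 < inner ℝ v₀ φ := by
    have h1 : inner ℝ v₀ φ = m + inner ℝ v₀ (φ - vd) := by rw [inner_sub_right]; ring
    have h2 := (abs_le.1 (abs_real_inner_le_norm v₀ (φ - vd))).1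
    have h3 : ‖v₀‖ * ‖φ - vd‖ < m := by
      have h4 := hpd.trans_le (min_le_right _ _)
      rw [lt_div_iff₀ (by positivity)] at h4
      nlinarith [norm_nonneg (φ - vd)]
    linarith
  have h : DegenerateParabolic.IsGroundState a p :=
    { smooth := ha_smooth, pos := ha_pos, left := ha_left, right := ha_right, poly_pos := hp }
  obtain ⟨J, R, hJ⟩ := DegenerateParabolic.exists_isGraphResolvent
    (DegenerateParabolic.twistedGraph a h.twistLInf) (h.isClosed_twistedGraph _)
  obtain ⟨S, hS⟩ := (hJ.isResolventComplement h.eq_zero_of_inner).exists_semigroup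
  obtain ⟨β, hβ, hβ'⟩ := h.tendsto_semigroup hJ hS v₀
  rw [← hφ] at hβ hβ'
  have hβpos : 0 < β := by
    rw [← hβ'] at hpos'
    exact pos_of_mul_pos_left hpos' (sq_nonneg _)
  have hlim : Filter.Tendsto (fun t => β⁻¹ • S t v₀) Filter.atTop (nhds φ) := by
    have := hβ.const_smul β⁻¹
    rwa [inv_smul_smul₀ hβpos.ne'] at this
  -- T ≥ 1 makes the division by T in δ legitimate.
  obtain ⟨T, hT, hT1⟩ := ((Metric.tendsto_nhds.1 hlim (ε / 2) (by positivity)).and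
    (Filter.eventually_ge_atTop 1)).exists
  have hT0 : 0 ≤ T := zero_le_one.trans hT1
  -- This δ gives exp(δT) = 1/β, so that the state at time T is β⁻¹ S(T)v₀. The semigroup does not
  -- depend on δ, so T can be fixed first.
  have hsol := h.isWeakSolution hJ hS hT0 (Real.log β⁻¹ / T) v₀
  refine ⟨T, hT0, _, _, hsol, fun w hw => h.eqOn_of_isWeakSolution hJ hT0 hsol hw, ?_⟩
  rw [div_mul_cancel₀ _ (by linarith : T ≠ 0), Real.exp_log (inv_pos.2 hβpos)]
  rw [dist_eq_norm] at hT
  calc ‖β⁻¹ • S T v₀ - vd‖ = ‖(β⁻¹ • S T v₀ - φ) + (φ - vd)‖ := by congr 1; abel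
    _ ≤ ε / 2 + ε / 2 :=
      (norm_add_le _ _).trans (add_le_add hT.le (hpd.le.trans (min_le_left _ _)))
    _ = ε := add_halves ε
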